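/- **Setting.** A randomized algorithm $\mathcal A:\mathcal X^n\to\mathcal Y$ is $(\varepsilon,\delta)$-differentially private (DP) if for all $S,S'\in\mathcal X^n$ that agree on all but one coordinate and all $T\subseteq\mathcal Y$, $\mathbb P[\mathcal A(S)\in T]\le e^{\varepsilon}\,\mathbb P[\mathcal A(S')\in T]+\delta$. **The estimator.** Fix a constant $C_1>0$. The input is a dataset $S=\{(x_i,y_i)\}_{i=1}^n\subset\mathbb R^d\times\mathbb R$, privacy parameters $\varepsilon_0>0$, $\delta_0\in(0,1)$, and a failure probability $\zeta\in(0,1)$. 1. Let $k=\lfloor C_1\log(1/(\delta_0\zeta))/\varepsilon_0\rfloor$ and let $G_1,\dots,G_k$ be disjoint consecutive blocks of $b=\lfloor n/k\rfloor$ data points each (the at most $k-1$ left-over points are not used). 2. For each $j$ compute $\psi_j=\min_{\beta\in\mathbb R^d}\frac1{|G_j|}\sum_{i\in G_j}(y_i-\beta^\top x_i)^2$. 3. Partition $[0,\infty)$ into the bins $\{0\}$ and $[2^{m/4},2^{(m+1)/4})$, $m\in\mathbb Z$, and run the stability-based $(\varepsilon_0,\delta_0)$-DP histogram on $\psi_1,\dots,\psi_k$: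 with $\hat p_B=\frac1k|\{j:\psi_j\in B\}|$, a bin with $\hat p_B=0$ gets $\tilde p_B=0$; for every other bin draw independent Laplace noise $Z_B$ of scale $2/(\varepsilon_0k)$ and put $\tilde p_B=\hat p_B+Z_B$ if $\hat p_B+Z_B\ge\frac1k+\frac{2\log(2/\delta_0)}{\varepsilon_0k}$, and $\tilde p_B=0$ otherwise. 4. If all $\tilde p_B$ are $0$, return $\perp$. Otherwise return the left endpoint $\ell$ of a bin with $\tilde p_B>0$ for which $\tilde p_B$ is maximal. **Lemma.** (a) For all $C_1>0$, $\varepsilon_0>0$, $\delta_0,\zeta\in(0,1)$ and all $n,d$, the estimator is $(\varepsilon_0,\delta_0)$-DP. (b) There are absolute constants $c_1>0$ and $p\in\mathbb N$ such that for every $C_1\ge c_1$ there is a constant $C>0$, depending only on $C_1$, with the following property. Let $d\ge1$, $\varepsilon_0,\delta_0,\zeta\in(0,1)$ with $\delta_0\zeta\le\frac12$, and let $$n\ \ge\ C\cdot\frac{d\log(1/(\delta_0\zeta))}{\varepsilon_0}\cdot\Bigl(\bigl(1+\log\tfrac1{\varepsilon_0}\bigr)\bigl(1+\log\tfrac1{\delta_0}\bigr)\Bigr)^{p},$$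 that is, $n=\tilde O(d\log(1/(\delta_0\zeta))/\varepsilon_0)$ with a large enough constant, where $\tilde O$ hides factors polylogarithmic in $1/\varepsilon_0$ and $1/\delta_0$. Let $(x_i,y_i)$, $i=1,\dots,n$, be i.i.d. with $x_i\sim\mathcal N(0,\Sigma)$, $\Sigma\succ0$, and $y_i=x_i^\top\beta^*+z_i$, where $z_i\sim\mathcal N(0,\sigma^2)$, $\sigma\ge0$, and $\beta^*=\Sigma^{-1}\mathbb E[y_ix_i]$ (equivalently, $\mathbb E[z_ix_i]=0$, as is the case when $z_i$ is independent of $x_i$); $\Sigma$, $\beta^*$ and $\sigma$ are arbitrary and unknown to the algorithm. Then with probability at least $1-\zeta$, over the data and the randomness of the algorithm, the estimator returns a number $\ell$ (not $\perp$) with $$\frac1{\sqrt2}\,\sigma^2\ \le\ \ell\ \le\ \sqrt2\,\sigma^2 .$$ -/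

import Mathlib

open MeasureTheory ProbabilityTheory
open scoped ENNReal NNReal Matrix

/-- A randomized algorithm on datasets of size `n` is a map `A : 𝒳ⁿ → Ω → 𝒴`, whose second argument
is the internal randomness, drawn from `μ`. It is `(ε, δ)`-differentially private if for all
datasets `S, S'` that agree on all but one coordinate and for all sets `T` of outputs,
`ℙ[A(S) ∈ T] ≤ e^ε ℙ[A(S') ∈ T] + δ`. -/
def IsDP {𝒳 Ω 𝒴 : Type*} [MeasurableSpace Ω] {n : ℕ} (μ : Measure Ω)
    (A : (Fin n → 𝒳) → Ω → 𝒴) (ε δ : ℝ) : Prop :=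
  ∀ S S' : Fin n → 𝒳, (∃ i, ∀ j, j ≠ i → S j = S' j) → ∀ T : Set 𝒴,
    μ {ω | A S ω ∈ T} ≤
      ENNReal.ofReal (Real.exp ε) * μ {ω | A S' ω ∈ T} + ENNReal.ofReal δ

/-- The standard Laplace distribution, with density `x ↦ exp (-|x|) / 2`. -/
noncomputable def stdLaplace : Measure ℝ :=
  volume.withDensity fun x => ENNReal.ofReal (Real.exp (-|x|) / 2)

instance isProbabilityMeasure_stdLaplace : IsProbabilityMeasure stdLaplace := by
  have hI : ∫ x : ℝ, Real.exp (-|x|) / 2 = 1 := by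
    rw [integral_comp_abs (f := fun x => Real.exp (-x) / 2), integral_div,
      integral_exp_neg_Ioi_zero]
    norm_num
  have hint : Integrable fun x : ℝ => Real.exp (-|x|) / 2 := by
    by_contra h
    rw [integral_undef h] at hI
    exact zero_ne_one hI
  refine ⟨?_⟩
  rw [stdLaplace, withDensity_apply _ MeasurableSet.univ, Measure.restrict_univ,
    ← ofReal_integral_eq_lintegral_ofReal hint
      (Filter.Eventually.of_forall fun x => by positivity), hI, ENNReal.ofReal_one]

/-- Independent standard Laplace variables, one for each bin. -/
noncomputable def binNoise (ι : Type*) : Measure (ι → ℝ) :=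
  Measure.infinitePi fun _ => stdLaplace

/-- The empirical frequency `p̂ᵢ` of the bin `B i` among the points `X₁, …, X_k`. -/
noncomputable def empFreq {𝒳 ι : Type*} {k : ℕ} (B : ι → Set 𝒳) (X : Fin k → 𝒳) (i : ι) : ℝ :=
  ({j | X j ∈ B i} : Set (Fin k)).ncard / (k : ℝ)

/-- The stability-based histogram. A bin with no points gets the value `0`. To the frequency of a
bin with points, Laplace noise of scale `2 / (ε k)` is added (`ω i` being standard Laplace), and
the result is released if it is at least `1 / k + 2 log (2 / δ) / (ε k)`, and replaced by `0`
otherwise. -/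
noncomputable def stableHistogram {𝒳 ι : Type*} {k : ℕ} (ε δ : ℝ) (B : ι → Set 𝒳)
    (X : Fin k → 𝒳) (ω : ι → ℝ) (i : ι) : ℝ :=
  open Classical in
  if empFreq B X i = 0 then 0
  else if empFreq B X i + 2 / (ε * k) * ω i < 1 / k + 2 * Real.log (2 / δ) / (ε * k) then 0
  else empFreq B X i + 2 / (ε * k) * ω i

/-- `i` is a non-empty bin of the histogram `p` with the maximum value (among several such bins,
the one that comes first in a fixed enumeration; with Laplace noise, ties between non-empty bins
have probability zero). -/
def IsTopBin {ι : Type*} [Encodable ι] (p : ι → ℝ) (i : ι) : Prop :=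
  0 < p i ∧ ∀ j, p j < p i ∨ (p j = p i ∧ Encodable.encode i ≤ Encodable.encode j)

/-- The non-empty bin of the histogram `p` with the maximum value, `none` if all bins are empty. -/
noncomputable def topBin {ι : Type*} [Encodable ι] (p : ι → ℝ) : Option ι :=
  open Classical in
  if h : ∃ i, IsTopBin p i then some h.choose else none

/-- The partition of `[0, ∞)` into the point `{0}` (index `none`) and the geometrically increasing
intervals `[2^(m/4), 2^((m+1)/4))`, `m ∈ ℤ` (index `some m`). -/
noncomputable def geomBin : Option ℤ → Set ℝ
  | none => {0}
  | some m => Set.Ico ((2 : ℝ) ^ ((m : ℝ) / 4)) ((2 : ℝ) ^ (((m : ℝ) + 1) / 4))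

/-- The left endpoint of a bin. -/
noncomputable def geomBinLeft : Option ℤ → ℝ
  | none => 0
  | some m => (2 : ℝ) ^ ((m : ℝ) / 4)

/-- The `j`-th block of `b` consecutive indices. For `k = ⌊C₁ log(1/(δ₀ζ))/ε₀⌋` blocks of size
`b = ⌊n/k⌋`, the at most `k - 1` last indices belong to no block. -/
def block (n b j : ℕ) : Finset (Fin n) :=
  Finset.univ.filter fun i => j * b ≤ (i : ℕ) ∧ (i : ℕ) < (j + 1) * b

/-- `min_β (1/|G|) ∑_{i ∈ G} (y_i - βᵀ x_i)²` for the subset `G` of the dataset `S`. -/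
noncomputable def minMeanSq {n d : ℕ} (S : Fin n → EuclideanSpace ℝ (Fin d) × ℝ)
    (G : Finset (Fin n)) : ℝ :=
  ⨅ β : EuclideanSpace ℝ (Fin d),
    (1 / (G.card : ℝ)) * ∑ i ∈ G, ((S i).2 - inner ℝ β (S i).1) ^ 2

/-- The number `k` of subsets in the partition. -/
noncomputable def numBlocks (C₁ ε₀ δ₀ ζ : ℝ) : ℕ :=
  ⌊C₁ * Real.log (1 / (δ₀ * ζ)) / ε₀⌋₊

/-- The private estimator of `σ²`: compute `ψ_j = min_β (1/|G_j|) ∑_{i ∈ G_j} (y_i - βᵀ x_i)²` on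
each of the `k` subsets, run the private histogram on the `ψ_j` with the geometric bins, and return
the left endpoint of the top bin (`none`, i.e. `⊥`, if all bins are empty). The argument `ω` is the
internal randomness, to be drawn from `binNoise (Option ℤ)`. -/
noncomputable def sigmaSqEstimator {n d : ℕ} (C₁ ε₀ δ₀ ζ : ℝ)
    (S : Fin n → EuclideanSpace ℝ (Fin d) × ℝ) (ω : Option ℤ → ℝ) : Option ℝ :=
  let k := numBlocks C₁ ε₀ δ₀ ζ
  let ψ : Fin k → ℝ := fun j => minMeanSq S (block n (n / k) j)
  (topBin (stableHistogram ε₀ δ₀ geomBin ψ ω)).map geomBinLeft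

/-- `P` is the law of a pair `(x, y)` in the Gaussian linear model: `x ∼ N(0, M)` with `M` positive
definite, `y = xᵀβ + z` with `z ∼ N(0, σ²)`, and `β = M⁻¹ 𝔼[y x]`. (The last condition says that
`z` is uncorrelated with `x`; it holds in particular if `z` is independent of `x`.) -/
structure IsGaussianLinearModel {d : ℕ} (P : Measure (EuclideanSpace ℝ (Fin d) × ℝ))
    (M : Matrix (Fin d) (Fin d) ℝ) (β : EuclideanSpace ℝ (Fin d)) (σ : ℝ≥0) : Prop where
  posDef : M.PosDef
  law_x : P.map Prod.fst = multivariateGaussian 0 M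
  law_z : P.map (fun q => q.2 - inner ℝ q.1 β) = gaussianReal 0 (σ ^ 2)
  param : β = WithLp.toLp 2 (M⁻¹ *ᵥ fun j => ∫ q, q.2 * q.1 j ∂P)

/-! Privacy. One data point lies in at most one block, so changing it moves at most one `ψ_j` and
alters at most two bin frequencies, each by at most `1/k`. Where a bin is non-empty for both
datasets, shifting its Laplace variable by at most `ε/2` compensates the change; two such shifts
cost a factor `e^ε`. A bin that is empty for one dataset has frequency at most `1/k` for the other,
and is released only if its noise reaches `log (2/δ)`, which is rare enough to be paid for by `δ`
(`stableHistogram_dp`).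

Accuracy on one block. The residual `y - ⟪γ, x⟫` equals `z + ⟪β - γ, x⟫`, that is, `σ` times a
linear form evaluated at a vector `(1, u)` of a space of dimension `d + 1`, once `z` is divided by
`σ` and `x` is whitened. Since `z` and `x` are uncorrelated, the second moment of the form at `(a,
u)` is `a² + ‖u‖²`. A lower bound for the minimum over all `γ` thus follows from a uniform lower
bound for the empirical quadratic form on a sphere, obtained from a net and Chernoff bounds
(`exists_event_sum_sq_ge`); inserting `γ = β` gives the upper bound. Independence of `z` and `x` is
never needed: exponential moments of the sum are controlled by AM-GM.

Aggregation. With block size of order `d (1 + log (1/ε₀))`, a block fails with probability at most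
`ε₀/1000`, and blocks are independent, so with `Λ = log (1/(δ₀ζ))` fewer than `C₁Λ/200` blocks fail,
up to probability `ζ/2` (`measure_card_events_ge_le`). The other `ψ_j` fall into four bins with
admissible left endpoints. Only non-empty bins receive noise, and there are at most `4 + C₁Λ/200` of
them, a number free of `1/ε₀`; this is why the failure rate is made proportional to `ε₀`, and why a
union bound over the noise succeeds with `ε₀ k` of order `C₁Λ`. One of the four bins then wins
(`topBin_stableHistogram_mem`). -/

/-! ### Laplace noise: tails and cost of a shift. -/

theorem stdLaplace_shift_le (c : ℝ) {s : Set ℝ} (hs : MeasurableSet s) :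
    stdLaplace {x | x + c ∈ s} ≤ ENNReal.ofReal (Real.exp |c|) * stdLaplace s := by
  have hf : Measurable fun x : ℝ => ENNReal.ofReal (Real.exp (-|x|) / 2) := by fun_prop
  have hs' : MeasurableSet {x | x + c ∈ s} := hs.preimage (measurable_add_const c)
  rw [stdLaplace, withDensity_apply _ hs', withDensity_apply _ hs, ← lintegral_indicator hs',
    ← lintegral_indicator hs, ← lintegral_const_mul _ (hf.indicator hs),
    ← lintegral_add_right_eq_self (fun x => _ * _) c]
  refine lintegral_mono fun x => ?_
  by_cases hx : x + c ∈ s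
  · rw [Set.indicator_of_mem (by exact hx), Set.indicator_of_mem hx,
      ← ENNReal.ofReal_mul (Real.exp_pos _).le]
    refine ENNReal.ofReal_le_ofReal ?_
    rw [← mul_div_assoc, ← Real.exp_add]
    have := abs_add_le x c
    gcongr
    linarith
  · rw [Set.indicator_of_notMem (by exact hx)]
    exact zero_le

theorem stdLaplace_Ici {r : ℝ} (hr : 0 ≤ r) :
    stdLaplace (Set.Ici r) = ENNReal.ofReal (Real.exp (-r) / 2) := by
  rw [stdLaplace, withDensity_apply _ measurableSet_Ici, setLIntegral_congr_fun
    (g := fun x => ENNReal.ofReal (Real.exp (-x) / 2)) measurableSet_Ici,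
    setLIntegral_congr Ioi_ae_eq_Ici.symm,
    ← ofReal_integral_eq_lintegral_ofReal]
  · rw [integral_div, integral_exp_neg_Ioi]
  · exact (integrableOn_exp_neg_Ioi r).div_const 2
  · exact Filter.Eventually.of_forall fun x => by positivity
  · intro x hx
    simp only
    rw [abs_of_nonneg (hr.trans hx)]

theorem stdLaplace_Iic {r : ℝ} (hr : 0 ≤ r) :
    stdLaplace (Set.Iic (-r)) = ENNReal.ofReal (Real.exp (-r) / 2) := by
  rw [stdLaplace, withDensity_apply _ measurableSet_Iic, setLIntegral_congr_fun
    (g := fun x => ENNReal.ofReal (Real.exp x / 2)) measurableSet_Iic,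
    ← ofReal_integral_eq_lintegral_ofReal]
  · rw [integral_div, integral_exp_Iic]
  · exact (integrableOn_exp_Iic (-r)).div_const 2
  · exact Filter.Eventually.of_forall fun x => by positivity
  · intro x hx
    simp only
    rw [abs_of_nonpos (le_trans hx (by linarith)), neg_neg]

theorem stdLaplace_abs_ge_le {r : ℝ} (hr : 0 ≤ r) :
    stdLaplace {x | r ≤ |x|} ≤ ENNReal.ofReal (Real.exp (-r)) := by
  have : {x : ℝ | r ≤ |x|} ⊆ Set.Iic (-r) ∪ Set.Ici r := by
    intro x hx
    rcases le_abs'.1 (show r ≤ |x| from hx) with h | h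
    · exact Or.inl h
    · exact Or.inr h
  refine (measure_mono this).trans ((measure_union_le _ _).trans ?_)
  rw [stdLaplace_Ici hr, stdLaplace_Iic hr, ← ENNReal.ofReal_add (by positivity) (by positivity),
    add_halves]

instance isProbabilityMeasure_binNoise (ι : Type*) : IsProbabilityMeasure (binNoise ι) := by
  unfold binNoise; infer_instance

theorem binNoise_eval {ι : Type*} (i : ι) {s : Set ℝ} (hs : MeasurableSet s) :
    binNoise ι {ω | ω i ∈ s} = stdLaplace s :=
  (measurePreserving_eval_infinitePi (fun _ : ι => stdLaplace) i).measure_preimage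
    hs.nullMeasurableSet

/-- Resampling one coordinate independently does not change the law. This permits Fubini in a single
coordinate of an infinite product. -/
theorem measurePreserving_update {ι : Type*} [DecidableEq ι] (a : ι) :
    MeasurePreserving (fun p : (ι → ℝ) × ℝ => Function.update p.1 a p.2)
      ((binNoise ι).prod stdLaplace) (binNoise ι) := by
  have hm : Measurable fun p : (ι → ℝ) × ℝ => Function.update p.1 a p.2 := by
    refine measurable_pi_iff.2 fun i => ?_
    by_cases h : i = a
    · subst h; simpa using measurable_snd
    · simp only [Function.update_of_ne h]; fun_prop
  refine ⟨hm, Measure.eq_infinitePi (fun _ => stdLaplace) fun s t ht => ?_⟩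
  rw [Measure.map_apply hm (MeasurableSet.pi s.countable_toSet fun i _ => ht i)]
  have key : (fun p : (ι → ℝ) × ℝ => Function.update p.1 a p.2) ⁻¹' Set.pi s t =
      (Set.pi (s.erase a : Finset ι) t) ×ˢ (if a ∈ s then t a else Set.univ) := by
    ext p
    simp only [Set.mem_preimage, Set.mem_pi, Finset.mem_coe, Set.mem_prod, Finset.mem_erase]
    constructor
    · intro h
      refine ⟨fun i hi => by simpa [hi.1] using h i hi.2, ?_⟩
      split_ifs with ha
      · simpa using h a ha
      · trivial
    · rintro ⟨h1, h2⟩ i hi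
      by_cases h : i = a
      · subst h; simpa [hi] using h2
      · simpa [h] using h1 i ⟨h, hi⟩
  rw [key, Measure.prod_prod, binNoise, Measure.infinitePi_pi _ (fun i _ => ht i)]
  split_ifs with ha
  · rw [Finset.prod_erase_mul _ _ ha]
  · rw [measure_univ, mul_one, Finset.erase_eq_of_notMem ha]

theorem binNoise_shift_single_le {ι : Type*} [DecidableEq ι] (a : ι) (c : ℝ) (U : Set (ι → ℝ)) :
    binNoise ι {ω | ω + Pi.single a c ∈ U} ≤
      ENNReal.ofReal (Real.exp |c|) * binNoise ι U := by
  -- `U` is arbitrary, since privacy is demanded for all output sets; a measurable hull has the same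
  -- measure and makes Fubini available.
  set V := toMeasurable (binNoise ι) U
  have hV : MeasurableSet V := measurableSet_toMeasurable _ _
  have hshift : Measurable fun ω : ι → ℝ => ω + (Pi.single a c : ι → ℝ) :=
    measurable_add_const (Pi.single a c : ι → ℝ)
  have hV' : MeasurableSet {ω : ι → ℝ | ω + (Pi.single a c : ι → ℝ) ∈ V} := hV.preimage hshift
  have hmp := measurePreserving_update (ι := ι) a
  rw [← measure_toMeasurable U]
  calc binNoise ι {ω | ω + Pi.single a c ∈ U} ≤ binNoise ι {ω | ω + Pi.single a c ∈ V} :=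
        measure_mono fun ω hω => subset_toMeasurable _ _ hω
    _ = ∫⁻ ω, stdLaplace {x | x + c ∈ {y | Function.update ω a y ∈ V}} ∂(binNoise ι) := by
        rw [← hmp.measure_preimage hV'.nullMeasurableSet,
          Measure.prod_apply (hV'.preimage hmp.measurable)]
        refine lintegral_congr fun ω => ?_
        congr 1
        ext x
        have : Function.update ω a x + Pi.single a c = Function.update ω a (x + c) := by
          ext i
          by_cases h : i = a
          · subst h; simp
          · simp [h]
        simp [this]
    _ ≤ ∫⁻ ω, ENNReal.ofReal (Real.exp |c|) *
          stdLaplace {y | Function.update ω a y ∈ V} ∂(binNoise ι) :=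
        lintegral_mono fun ω => stdLaplace_shift_le c
          ((hV.preimage hmp.measurable).preimage measurable_prodMk_left)
    _ = ENNReal.ofReal (Real.exp |c|) * binNoise ι V := by
        rw [← hmp.measure_preimage hV.nullMeasurableSet,
          Measure.prod_apply (hV.preimage hmp.measurable), lintegral_const_mul']
        · rfl
        · exact ENNReal.ofReal_ne_top

theorem binNoise_shift_le {ι : Type*} [DecidableEq ι] (s : Finset ι) (c : ι → ℝ)
    (U : Set (ι → ℝ)) :
    binNoise ι {ω | ω + ∑ i ∈ s, Pi.single i (c i) ∈ U} ≤
      ENNReal.ofReal (Real.exp (∑ i ∈ s, |c i|)) * binNoise ι U := by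
  induction s using Finset.induction_on with
  | empty => simp
  | insert a s ha ih =>
    have h := binNoise_shift_single_le a (c a) {ω | ω + ∑ i ∈ s, Pi.single i (c i) ∈ U}
    simp only [Set.mem_ofPred_eq, add_assoc] at h
    rw [Finset.sum_insert ha, Finset.sum_insert ha, Real.exp_add,
      ENNReal.ofReal_mul (Real.exp_pos _).le, mul_assoc]
    exact h.trans (by gcongr)

/-! ### Sensitivity of the frequencies and privacy of the histogram. -/

open Classical in
theorem empFreq_eq_rest_add {𝒳 ι : Type*} {k : ℕ} (B : ι → Set 𝒳) (X : Fin k → 𝒳) (j₀ : Fin k)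
    (i : ι) : empFreq B X i =
      ((({j | j ≠ j₀ ∧ X j ∈ B i} : Set (Fin k)).ncard : ℝ) + if X j₀ ∈ B i then 1 else 0) / k := by
  unfold empFreq
  congr 1
  split_ifs with h
  · have : ({j | X j ∈ B i} : Set (Fin k)) = insert j₀ {j | j ≠ j₀ ∧ X j ∈ B i} := by
      ext j
      by_cases hj : j = j₀ <;> simp [hj, h]
    rw [this, Set.ncard_insert_of_notMem (by simp) (Set.toFinite _)]
    push_cast
    ring
  · have : ({j | X j ∈ B i} : Set (Fin k)) = {j | j ≠ j₀ ∧ X j ∈ B i} := by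
      ext j
      by_cases hj : j = j₀ <;> simp [hj, h]
    rw [this, add_zero]

theorem exists_finset_mem_iff_of_pairwise_disjoint {𝒳 ι : Type*} {B : ι → Set 𝒳}
    (hB : Pairwise fun i j => Disjoint (B i) (B j)) (x : 𝒳) :
    ∃ s : Finset ι, s.card ≤ 1 ∧ ∀ i, x ∈ B i ↔ i ∈ s := by
  by_cases h : ∃ i, x ∈ B i
  · obtain ⟨i, hi⟩ := h
    refine ⟨{i}, by simp, fun j => ?_⟩
    rw [Finset.mem_singleton]
    constructor
    · intro hj
      by_contra hne
      exact Set.disjoint_left.1 (hB hne) hj hi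
    · rintro rfl
      exact hi
  · push Not at h
    exact ⟨∅, by simp, fun i => by simp [h i]⟩

theorem empFreq_diff {𝒳 ι : Type*} [DecidableEq ι] {k : ℕ} {B : ι → Set 𝒳}
    (hB : Pairwise fun i j => Disjoint (B i) (B j)) {X X' : Fin k → 𝒳} {j₀ : Fin k}
    (hX : ∀ j, j ≠ j₀ → X j = X' j) :
    ∃ D : Finset ι, D.card ≤ 2 ∧ (∀ i, i ∉ D → empFreq B X i = empFreq B X' i) ∧
      (∀ i, |empFreq B X i - empFreq B X' i| ≤ 1 / k) ∧
      (∀ i, empFreq B X i = 0 → empFreq B X' i = 0 ∨ empFreq B X' i = 1 / k) ∧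
      (∀ i, empFreq B X' i = 0 → empFreq B X i = 0 ∨ empFreq B X i = 1 / k) := by
  classical
  have hk : (0 : ℝ) < k := by exact_mod_cast j₀.pos
  obtain ⟨s, hs, hs'⟩ := exists_finset_mem_iff_of_pairwise_disjoint hB (X j₀)
  obtain ⟨t, ht, ht'⟩ := exists_finset_mem_iff_of_pairwise_disjoint hB (X' j₀)
  have hm : ∀ i, ({j | j ≠ j₀ ∧ X j ∈ B i} : Set (Fin k)) = {j | j ≠ j₀ ∧ X' j ∈ B i} := by
    intro i
    ext j
    simp only [Set.mem_ofPred_eq]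
    exact and_congr_right fun h => by rw [hX j h]
  have h1 := fun i => empFreq_eq_rest_add B X j₀ i
  have h2 := fun i => empFreq_eq_rest_add B X' j₀ i
  simp only [hs', ht', ← hm] at h1 h2
  -- `s` and `t` contain the bin left and the bin entered by the changed point, if any.
  refine ⟨s ∪ t, (Finset.card_union_le _ _).trans (by lia), fun i hi => ?_, fun i => ?_,
    fun i => ?_, fun i => ?_⟩
  · rw [Finset.mem_union, not_or] at hi
    rw [h1, h2, if_neg hi.1, if_neg hi.2]
  · rw [h1, h2, ← sub_div, abs_div, abs_of_pos hk]
    gcongr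
    split_ifs <;> simp
  all_goals
    rw [h1, h2, div_eq_zero_iff, div_eq_zero_iff, or_iff_left hk.ne', or_iff_left hk.ne',
      div_left_inj' hk.ne']
    set m : ℝ := (({j | j ≠ j₀ ∧ X j ∈ B i} : Set (Fin k)).ncard : ℝ) with hmdef
    have hm0 : 0 ≤ m := Nat.cast_nonneg _
    intro h
    split_ifs at h ⊢ <;> first | (left; linarith) | (right; linarith)

theorem stableHistogram_dp {𝒳 ι : Type*} {k : ℕ} {ε δ : ℝ} (hε : 0 < ε) (hδ : 0 < δ) (hδ1 : δ < 1)
    {B : ι → Set 𝒳} (hB : Pairwise fun i j => Disjoint (B i) (B j)) {X X' : Fin k → 𝒳} {j₀ : Fin k}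
    (hX : ∀ j, j ≠ j₀ → X j = X' j) (U : Set (ι → ℝ)) :
    binNoise ι {ω | stableHistogram ε δ B X ω ∈ U} ≤
      ENNReal.ofReal (Real.exp ε) * binNoise ι {ω | stableHistogram ε δ B X' ω ∈ U} +
        ENNReal.ofReal δ := by
  classical
  have hk : (0 : ℝ) < k := by exact_mod_cast j₀.pos
  obtain ⟨D, hD, hDeq, hDle, hz, hz'⟩ := empFreq_diff hB hX
  set L : ℝ := Real.log (2 / δ) with hLdef
  have hL : 0 ≤ L := Real.log_nonneg (by rw [le_div_iff₀ hδ]; linarith)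
  -- The shift that turns the noisy frequency for `X'` into that for `X`. No shift is made where one
  -- of the two frequencies vanishes; there both outputs are `0` unless the noise is large.
  set c : ι → ℝ := fun i => if empFreq B X i = 0 ∨ empFreq B X' i = 0 then 0
    else (empFreq B X i - empFreq B X' i) / (2 / (ε * k)) with hc
  have hc0 : ∀ i, i ∉ D → c i = 0 := fun i hi => by simp [hc, hDeq i hi]
  have hsum : ∀ i, (∑ a ∈ D, Pi.single a (c a) : ι → ℝ) i = c i := by
    intro i
    rw [Finset.sum_apply]
    by_cases hi : i ∈ D
    · rw [Finset.sum_eq_single_of_mem i hi (fun j _ hj => by simp [hj.symm])]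
      simp
    · rw [hc0 i hi]
      exact Finset.sum_eq_zero fun j hj => by
        rw [Pi.single_eq_of_ne (by rintro rfl; exact hi hj)]
  have habs : ∀ i, |c i| ≤ ε / 2 := by
    intro i
    simp only [hc]
    split_ifs
    · rw [abs_zero]; positivity
    · rw [abs_div, abs_of_pos (show 0 < 2 / (ε * k) by positivity), div_le_iff₀ (by positivity)]
      refine (hDle i).trans (le_of_eq ?_)
      field_simp
  have hclose : ∀ ω : ι → ℝ, (∀ i ∈ D, ω i < L) →
      stableHistogram ε δ B X ω = stableHistogram ε δ B X' (ω + ∑ a ∈ D, Pi.single a (c a)) := by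
    intro ω hω
    have hbelow : ∀ i ∈ D, 1 / (k : ℝ) + 2 / (ε * k) * ω i <
        1 / k + 2 * Real.log (2 / δ) / (ε * k) := by
      intro i hi
      have h1 : 2 / (ε * k) * ω i < 2 / (ε * k) * L :=
        mul_lt_mul_of_pos_left (hω i hi) (by positivity)
      have h2 : 2 / (ε * k) * L = 2 * L / (ε * k) := by ring
      linarith
    ext i
    simp only [stableHistogram, Pi.add_apply, hsum]
    by_cases hi : i ∈ D
    · by_cases h1 : empFreq B X i = 0
      · rcases hz i h1 with h2 | h2
        · simp [h1, h2]
        · have hci : c i = 0 := by simp [hc, h1]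
          rw [if_pos h1, hci, add_zero, h2, if_neg (by positivity), if_pos (hbelow i hi)]
      · by_cases h2 : empFreq B X' i = 0
        · rcases hz' i h2 with h3 | h3
          · exact absurd h3 h1
          · rw [if_pos h2, h3, if_neg (by positivity), if_pos (hbelow i hi)]
        · have hci : c i = (empFreq B X i - empFreq B X' i) / (2 / (ε * k)) := by
            simp [hc, h1, h2]
          have : empFreq B X' i + 2 / (ε * k) * (ω i + c i) =
              empFreq B X i + 2 / (ε * k) * ω i := by
            rw [hci, mul_add, mul_div_cancel₀ _ (by positivity)]
            ring
          rw [if_neg h1, if_neg h2, this]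
    · rw [hc0 i hi, hDeq i hi, add_zero]
  -- Each of the at most two bins contributes `exp (-L) / 2 = δ / 4`.
  have hbad : binNoise ι {ω | ∃ i ∈ D, L ≤ ω i} ≤ ENNReal.ofReal δ := by
    have : {ω : ι → ℝ | ∃ i ∈ D, L ≤ ω i} = ⋃ i ∈ D, {ω | ω i ∈ Set.Ici L} := by
      ext ω; simp
    rw [this]
    refine (measure_biUnion_finset_le _ _).trans ?_
    simp only [binNoise_eval _ measurableSet_Ici, stdLaplace_Ici hL, Finset.sum_const, nsmul_eq_mul]
    rw [← ENNReal.ofReal_natCast, ← ENNReal.ofReal_mul (Nat.cast_nonneg _)]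
    refine ENNReal.ofReal_le_ofReal ?_
    rw [hLdef, Real.exp_neg, Real.exp_log (by positivity), inv_div]
    have : (D.card : ℝ) ≤ 2 := by exact_mod_cast hD
    nlinarith
  have hsub : {ω | stableHistogram ε δ B X ω ∈ U} ⊆
      {ω | ω + ∑ a ∈ D, Pi.single a (c a) ∈ {ω | stableHistogram ε δ B X' ω ∈ U}} ∪
        {ω | ∃ i ∈ D, L ≤ ω i} := by
    intro ω hω
    by_cases h : ∃ i ∈ D, L ≤ ω i
    · exact Or.inr h
    · push Not at h
      left
      simp only [Set.mem_ofPred_eq] at hω ⊢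
      rwa [← hclose ω h]
  refine (measure_mono hsub).trans ((measure_union_le _ _).trans (add_le_add ?_ hbad))
  refine (binNoise_shift_le D c _).trans ?_
  gcongr
  calc ∑ i ∈ D, |c i| ≤ ∑ i ∈ D, ε / 2 := Finset.sum_le_sum fun i _ => habs i
    _ = D.card * (ε / 2) := by simp
    _ ≤ 2 * (ε / 2) := by gcongr; exact_mod_cast hD
    _ = ε := by ring

/-! ### The geometric bins and privacy of the estimator. -/

theorem mem_geomBin_some {x : ℝ} {m : ℤ} : x ∈ geomBin (some m) ↔
    0 < x ∧ ⌊4 * Real.logb 2 x⌋ = m := by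
  simp only [geomBin, Set.mem_Ico, Int.floor_eq_iff]
  constructor
  · rintro ⟨h1, h2⟩
    have hx : 0 < x := lt_of_lt_of_le (by positivity) h1
    refine ⟨hx, ?_, ?_⟩
    · have := (Real.le_logb_iff_rpow_le one_lt_two hx).2 h1
      linarith
    · have := (Real.logb_lt_iff_lt_rpow one_lt_two hx).2 h2
      linarith
  · rintro ⟨hx, h1, h2⟩
    exact ⟨(Real.le_logb_iff_rpow_le one_lt_two hx).1 (by linarith),
      (Real.logb_lt_iff_lt_rpow one_lt_two hx).1 (by linarith)⟩

theorem pairwise_disjoint_geomBin : Pairwise fun i j => Disjoint (geomBin i) (geomBin j) := by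
  intro i j hij
  rw [Set.disjoint_left]
  intro x hi hj
  cases i <;> cases j
  · exact hij rfl
  · exact (mem_geomBin_some.1 hj).1.ne' hi
  · exact (mem_geomBin_some.1 hi).1.ne' hj
  · exact hij (congrArg some ((mem_geomBin_some.1 hi).2.symm.trans (mem_geomBin_some.1 hj).2))

theorem minMeanSq_congr {n d : ℕ} {S S' : Fin n → EuclideanSpace ℝ (Fin d) × ℝ} {G : Finset (Fin n)}
    (h : ∀ i ∈ G, S i = S' i) : minMeanSq S G = minMeanSq S' G := by
  unfold minMeanSq
  congr 1
  ext β
  congr 1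
  exact Finset.sum_congr rfl fun i hi => by rw [h i hi]

theorem disjoint_block (n b : ℕ) {j j' : ℕ} (h : j ≠ j') : Disjoint (block n b j) (block n b j') := by
  rw [Finset.disjoint_left]
  intro i hi hi'
  simp only [block, Finset.mem_filter, Finset.mem_univ, true_and] at hi hi'
  have h1 : j < j' + 1 := lt_of_mul_lt_mul_right (hi.1.trans_lt hi'.2) (Nat.zero_le b)
  have h2 : j' < j + 1 := lt_of_mul_lt_mul_right (hi'.1.trans_lt hi.2) (Nat.zero_le b)
  lia

theorem sigmaSqEstimator_dp {C₁ ε₀ δ₀ ζ : ℝ} (hε : 0 < ε₀) (hδ : 0 < δ₀) (hδ1 : δ₀ < 1) (n d : ℕ) :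
    IsDP (n := n) (binNoise (Option ℤ)) (sigmaSqEstimator (d := d) C₁ ε₀ δ₀ ζ) ε₀ δ₀ := by
  rintro S S' ⟨i₀, hS⟩ T
  set k := numBlocks C₁ ε₀ δ₀ ζ with hkdef
  by_cases hblock : ∃ j : Fin k, i₀ ∈ block n (n / k) j
  · obtain ⟨j₀, hj₀⟩ := hblock
    refine stableHistogram_dp hε hδ hδ1 pairwise_disjoint_geomBin (j₀ := j₀)
      (X := fun j : Fin k => minMeanSq S (block n (n / k) j))
      (X' := fun j : Fin k => minMeanSq S' (block n (n / k) j)) (fun j hj => ?_)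
      {p | (topBin p).map geomBinLeft ∈ T}
    refine minMeanSq_congr fun i hi => hS i ?_
    rintro rfl
    exact Finset.disjoint_left.1 (disjoint_block n (n / k) (Fin.val_ne_of_ne hj)) hi hj₀
  -- The changed point is a left-over point (or `k = 0`), so the output does not change.
  · push Not at hblock
    have heq : sigmaSqEstimator C₁ ε₀ δ₀ ζ S = sigmaSqEstimator C₁ ε₀ δ₀ ζ S' := by
      have : (fun j : Fin k => minMeanSq S (block n (n / k) j)) =
          fun j : Fin k => minMeanSq S' (block n (n / k) j) := by
        ext j
        refine minMeanSq_congr fun i hi => hS i ?_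
        rintro rfl
        exact hblock j hi
      ext1 ω
      simp only [sigmaSqEstimator]
      rw [← hkdef, this]
    rw [heq]
    refine le_add_right (le_mul_of_one_le_left zero_le ?_)
    rw [ENNReal.one_le_ofReal]
    exact Real.one_le_exp hε.le

/-! ### Accuracy of the histogram when most points lie in four bins. -/

/-- There may be infinitely many bins, so finiteness of the set of positive ones is what makes the
maximum exist. -/
theorem exists_isTopBin {ι : Type*} [Encodable ι] {p : ι → ℝ} {s : Finset ι}
    (hs : ∀ i, i ∉ s → p i ≤ 0) (hp : ∃ i, 0 < p i) : ∃ i, IsTopBin p i := by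
  classical
  obtain ⟨i₀, hi₀⟩ := hp
  have hi₀s : i₀ ∈ s := by
    by_contra h
    exact absurd (hs i₀ h) (not_le.2 hi₀)
  obtain ⟨i₁, hi₁, hmax⟩ := s.exists_max_image p ⟨i₀, hi₀s⟩
  obtain ⟨i, hi, hmin⟩ := (s.filter fun i => p i = p i₁).exists_min_image Encodable.encode
    ⟨i₁, by simp [hi₁]⟩
  rw [Finset.mem_filter] at hi
  have hpos : 0 < p i := hi.2 ▸ hi₀.trans_le (hmax i₀ hi₀s)
  refine ⟨i, hpos, fun j => ?_⟩
  by_cases hj : j ∈ s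
  · rcases (hmax j hj).lt_or_eq with h | h
    · exact Or.inl (hi.2 ▸ h)
    · exact Or.inr ⟨h.trans hi.2.symm, hmin j (by simp [hj, h])⟩
  · exact Or.inl ((hs j hj).trans_lt hpos)

theorem exists_topBin_eq_some {ι : Type*} [Encodable ι] {p : ι → ℝ} (h : ∃ i, IsTopBin p i) :
    ∃ i, topBin p = some i ∧ IsTopBin p i :=
  ⟨h.choose, by simp [topBin, h], h.choose_spec⟩

/-- Each exceptional point occupies at most one bin. The count limits the number of noise variables
entering the union bound. -/
theorem exists_finset_nonempty_bins {𝒳 ι : Type*} [DecidableEq ι] {k : ℕ} {B : ι → Set 𝒳}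
    (hB : Pairwise fun i j => Disjoint (B i) (B j)) {X : Fin k → 𝒳} {F : Finset ι}
    {J : Finset (Fin k)} (hF : ∀ j, j ∉ J → ∃ i ∈ F, X j ∈ B i) :
    ∃ N : Finset ι, N.card ≤ F.card + J.card ∧ ∀ i, i ∉ N → empFreq B X i = 0 := by
  choose s hs hs' using fun j => exists_finset_mem_iff_of_pairwise_disjoint hB (X j)
  refine ⟨F ∪ J.biUnion s, ?_, fun i hi => ?_⟩
  · refine (Finset.card_union_le _ _).trans (Nat.add_le_add_left ?_ _)
    refine Finset.card_biUnion_le.trans ?_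
    calc ∑ j ∈ J, (s j).card ≤ ∑ j ∈ J, 1 := Finset.sum_le_sum fun j _ => hs j
      _ = J.card := by simp
  · simp only [Finset.mem_union, Finset.mem_biUnion, not_or, not_exists, not_and] at hi
    have : ({j | X j ∈ B i} : Set (Fin k)) = ∅ := by
      ext j
      simp only [Set.mem_ofPred_eq, Set.mem_empty_iff_false, iff_false]
      intro hj
      by_cases hjJ : j ∈ J
      · exact hi.2 j hjJ ((hs' j i).1 hj)
      · obtain ⟨i', hi', hj'⟩ := hF j hjJ
        by_cases h : i' = i
        · exact hi.1 (h ▸ hi')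
        · exact Set.disjoint_left.1 (hB h) hj' hj
    simp [empFreq, this]

theorem empFreq_le_of_notMem {𝒳 ι : Type*} {k : ℕ} {B : ι → Set 𝒳}
    (hB : Pairwise fun i j => Disjoint (B i) (B j)) {X : Fin k → 𝒳} {F : Finset ι}
    {J : Finset (Fin k)} (hF : ∀ j, j ∉ J → ∃ i ∈ F, X j ∈ B i) {i : ι} (hi : i ∉ F) :
    empFreq B X i ≤ J.card / k := by
  unfold empFreq
  gcongr
  rw [← Set.ncard_coe_finset]
  refine Set.ncard_le_ncard (fun j hj => ?_) (Set.toFinite _)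
  by_contra hjJ
  obtain ⟨i', hi', hj'⟩ := hF j hjJ
  by_cases h : i' = i
  · exact hi (h ▸ hi')
  · exact Set.disjoint_left.1 (hB h) hj' hj

/-- Pigeonhole: at least `19/20` of the points share at most four bins. -/
theorem exists_le_empFreq {𝒳 ι : Type*} {k : ℕ} (hk : 0 < k) {B : ι → Set 𝒳}
    {X : Fin k → 𝒳} {F : Finset ι}
    {J : Finset (Fin k)} (hF : ∀ j, j ∉ J → ∃ i ∈ F, X j ∈ B i) (hF4 : F.card ≤ 4)
    (hJ : (J.card : ℝ) ≤ k / 20) : ∃ i ∈ F, 19 / 80 ≤ empFreq B X i := by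
  classical
  have hk' : (0 : ℝ) < k := by exact_mod_cast hk
  by_contra! h
  have hsub : Jᶜ ⊆ F.biUnion fun i => Finset.univ.filter fun j => X j ∈ B i := by
    intro j hj
    obtain ⟨i, hi, hj'⟩ := hF j (Finset.mem_compl.1 hj)
    exact Finset.mem_biUnion.2 ⟨i, hi, by simpa using hj'⟩
  have hcard : (Jᶜ.card : ℝ) = k - J.card := by
    rw [Finset.card_compl, Nat.cast_sub (Finset.card_le_univ J)]
    simp
  have h1 : (Jᶜ.card : ℝ) ≤ ∑ i ∈ F, ((Finset.univ.filter fun j => X j ∈ B i).card : ℝ) := by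
    exact_mod_cast (Finset.card_le_card hsub).trans Finset.card_biUnion_le
  have hFne : F.Nonempty := by
    by_contra hne
    rw [Finset.not_nonempty_iff_eq_empty] at hne
    rw [hne] at h1
    simp only [Finset.sum_empty] at h1
    linarith
  have h3 : ∑ i ∈ F, ((Finset.univ.filter fun j => X j ∈ B i).card : ℝ) < 19 / 20 * k := by
    calc _ < ∑ i ∈ F, 19 / 80 * (k : ℝ) := by
          refine Finset.sum_lt_sum_of_nonempty hFne fun i hi => ?_
          have := h i hi
          rwa [empFreq, div_lt_iff₀ hk', Set.ncard_eq_toFinset_card', Set.toFinset_ofPred] at this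
      _ = F.card * (19 / 80 * (k : ℝ)) := by simp
      _ ≤ 4 * (19 / 80 * (k : ℝ)) := by gcongr; exact_mod_cast hF4
      _ = 19 / 20 * k := by ring
  linarith

/-- With noise at most `1/20`, a bin outside `F` reaches at most `1/20 + 1/20 = 1/10`, whereas the
fullest bin of `F` keeps at least `19/80 - 1/20 = 3/16`, which exceeds both `1/10` and the release
threshold `3/20`. -/
theorem topBin_stableHistogram_mem {𝒳 ι : Type*} [Encodable ι] {k : ℕ} {ε δ : ℝ} (hk : 0 < k)
    {B : ι → Set 𝒳} (hB : Pairwise fun i j => Disjoint (B i) (B j)) {X : Fin k → 𝒳} {F : Finset ι}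
    {J : Finset (Fin k)} (hF : ∀ j, j ∉ J → ∃ i ∈ F, X j ∈ B i) (hF4 : F.card ≤ 4)
    (hJ : (J.card : ℝ) ≤ k / 20) (hθ : 1 / (k : ℝ) + 2 * Real.log (2 / δ) / (ε * k) ≤ 3 / 20)
    {N : Finset ι} (hN : ∀ i, i ∉ N → empFreq B X i = 0) {ω : ι → ℝ}
    (hω : ∀ i ∈ N, |2 / (ε * k) * ω i| ≤ 1 / 20) :
    ∃ i ∈ F, topBin (stableHistogram ε δ B X ω) = some i := by
  have hk' : (0 : ℝ) < k := by exact_mod_cast hk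
  have hval : ∀ i, i ∉ F → stableHistogram ε δ B X ω i ≤ 1 / 10 := by
    intro i hi
    have h1 : empFreq B X i ≤ 1 / 20 := by
      refine (empFreq_le_of_notMem hB hF hi).trans ?_
      rw [div_le_iff₀ hk']
      linarith
    unfold stableHistogram
    split_ifs with h2 h3
    · norm_num
    · norm_num
    · have := hω i (by by_contra h; exact h2 (hN i h))
      have := (abs_le.1 this).2
      linarith
  obtain ⟨i₀, hi₀F, hi₀⟩ := exists_le_empFreq hk hF hF4 hJ
  have hval₀ : 3 / 20 < stableHistogram ε δ B X ω i₀ := by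
    have hne : empFreq B X i₀ ≠ 0 := by
      intro h
      rw [h] at hi₀
      norm_num at hi₀
    have := hω i₀ (by by_contra h; exact hne (hN i₀ h))
    have := (abs_le.1 this).1
    unfold stableHistogram
    rw [if_neg hne, if_neg (by linarith)]
    linarith
  obtain ⟨i, hi, htop⟩ := exists_topBin_eq_some (exists_isTopBin (s := N)
    (p := stableHistogram ε δ B X ω) (fun i hi => by simp [stableHistogram, hN i hi])
    ⟨i₀, by linarith⟩)
  refine ⟨i, ?_, hi⟩
  by_contra hiF
  have h1 := hval i hiF
  rcases htop.2 i₀ with h | h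
  · linarith
  · linarith [h.1]

theorem binNoise_topBin_ge {𝒳 ι : Type*} [Encodable ι] {k : ℕ} {ε δ : ℝ} (hk : 0 < k) (hε : 0 < ε)
    {B : ι → Set 𝒳} (hB : Pairwise fun i j => Disjoint (B i) (B j)) {X : Fin k → 𝒳} {F : Finset ι}
    {J : Finset (Fin k)} (hF : ∀ j, j ∉ J → ∃ i ∈ F, X j ∈ B i) (hF4 : F.card ≤ 4)
    (hJ : (J.card : ℝ) ≤ k / 20) (hθ : 1 / (k : ℝ) + 2 * Real.log (2 / δ) / (ε * k) ≤ 3 / 20) :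
    1 - ENNReal.ofReal ((4 + J.card) * Real.exp (-(ε * k / 40))) ≤
      binNoise ι {ω | ∃ i ∈ F, topBin (stableHistogram ε δ B X ω) = some i} := by
  classical
  have hk' : (0 : ℝ) < k := by exact_mod_cast hk
  obtain ⟨N, hNcard, hN⟩ := exists_finset_nonempty_bins hB hF
  -- Chosen so that noise of scale `2 / (ε k)` stays within `1/20` when the standard variable is at
  -- most `r` in absolute value.
  set r : ℝ := ε * k / 40 with hr
  have hr0 : 0 ≤ r := by positivity
  have hmr : MeasurableSet {x : ℝ | r ≤ |x|} := measurableSet_le (by fun_prop) (by fun_prop)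
  set A : Set (ι → ℝ) := ⋃ i ∈ N, {ω | ω i ∈ {x : ℝ | r ≤ |x|}} with hA
  have hAm : MeasurableSet A :=
    N.measurableSet_biUnion fun i _ => hmr.preimage (measurable_pi_apply i)
  have hAle : binNoise ι A ≤ ENNReal.ofReal ((4 + J.card) * Real.exp (-r)) := by
    refine (measure_biUnion_finset_le _ _).trans ?_
    calc ∑ i ∈ N, binNoise ι {ω | ω i ∈ {x : ℝ | r ≤ |x|}}
        ≤ ∑ i ∈ N, ENNReal.ofReal (Real.exp (-r)) := Finset.sum_le_sum fun i _ => by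
          rw [binNoise_eval i hmr]
          exact stdLaplace_abs_ge_le hr0
      _ = ENNReal.ofReal (N.card * Real.exp (-r)) := by
          rw [ENNReal.ofReal_mul (Nat.cast_nonneg _), ENNReal.ofReal_natCast]
          simp
      _ ≤ _ := by
          refine ENNReal.ofReal_le_ofReal ?_
          gcongr
          exact_mod_cast hNcard.trans (by lia)
  calc 1 - ENNReal.ofReal ((4 + J.card) * Real.exp (-r)) ≤ 1 - binNoise ι A :=
        tsub_le_tsub_left hAle _
    _ = binNoise ι Aᶜ := (prob_compl_eq_one_sub hAm).symm
    _ ≤ _ := measure_mono fun ω hω => by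
        refine topBin_stableHistogram_mem hk hB hF hF4 hJ hθ hN fun i hi => ?_
        simp only [hA, Set.mem_compl_iff, Set.mem_iUnion, Set.mem_ofPred_eq, not_exists,
          not_le] at hω
        rw [abs_mul, abs_of_pos (by positivity : 0 < 2 / (ε * k))]
        calc 2 / (ε * k) * |ω i| ≤ 2 / (ε * k) * r := by gcongr; exact (hω i hi).le
          _ = 1 / 20 := by rw [hr]; field_simp; norm_num

/-- Since `17/20 ≥ 2^(-1/4)` and `7/5 ≤ 2^(1/2)`, the number `4 log₂ x` lies in `[4L - 1, 4L + 2]`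
with `L = log₂ s`. Its floor takes at most four values, and rounding down costs less than one more
unit, so left endpoints have `log₂` within `1/2` of `L`. -/
theorem exists_finset_geomBin {s : ℝ} (hs : 0 ≤ s) :
    ∃ F : Finset (Option ℤ), F.card ≤ 4 ∧
      (∀ i ∈ F, 1 / √2 * s ≤ geomBinLeft i ∧ geomBinLeft i ≤ √2 * s) ∧
      ∀ x, 17 / 20 * s ≤ x → x ≤ 7 / 5 * s → ∃ i ∈ F, x ∈ geomBin i := by
  rcases hs.eq_or_lt with rfl | hs
  · refine ⟨{none}, by simp, by simp [geomBinLeft], fun x hx hx' => ⟨none, by simp, ?_⟩⟩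
    simp only [mul_zero] at hx hx'
    exact le_antisymm hx' hx
  set L := Real.logb 2 s with hL
  have hsL : (2 : ℝ) ^ L = s := Real.rpow_logb two_pos (by norm_num) hs
  have hl2 : 0 < Real.log 2 := Real.log_pos one_lt_two
  have hm1 : (⌊4 * L⌋ : ℝ) ≤ 4 * L := Int.floor_le _
  have hm2 : 4 * L < ⌊4 * L⌋ + 1 := Int.lt_floor_add_one _
  refine ⟨(Finset.Icc (⌊4 * L⌋ - 1) (⌊4 * L⌋ + 2)).map Function.Embedding.some, ?_, ?_, ?_⟩
  · rw [Finset.card_map, Int.card_Icc]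
    lia
  · simp only [Finset.mem_map, Finset.mem_Icc, Function.Embedding.some_apply, forall_exists_index,
      and_imp]
    rintro _ m h1 h2 rfl
    have h1' : (⌊4 * L⌋ : ℝ) - 1 ≤ m := by exact_mod_cast h1
    have h2' : (m : ℝ) ≤ ⌊4 * L⌋ + 2 := by exact_mod_cast h2
    have hr : √2 = (2 : ℝ) ^ (1 / 2 : ℝ) := Real.sqrt_eq_rpow 2
    constructor
    · rw [hr, one_div, ← Real.rpow_neg two_pos.le, ← hsL, ← Real.rpow_add two_pos]
      exact Real.rpow_le_rpow_of_exponent_le one_le_two (by linarith)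
    · rw [hr, ← hsL, ← Real.rpow_add two_pos]
      exact Real.rpow_le_rpow_of_exponent_le one_le_two (by linarith)
  · intro x hx hx'
    have hx0 : 0 < x := lt_of_lt_of_le (by positivity) hx
    have h1 : L - 1 / 4 ≤ Real.logb 2 x := by
      have h85 : -1 / 4 ≤ Real.logb 2 (17 / 20) := by
        have : Real.log (1 / 2) ≤ Real.log ((17 / 20) ^ 4) :=
          Real.log_le_log (by norm_num) (by norm_num)
        rw [Real.log_pow, one_div, Real.log_inv] at this
        rw [Real.logb, le_div_iff₀ hl2]
        push_cast at this
        linarith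
      have := Real.logb_le_logb_of_le one_lt_two (by positivity) hx
      rw [Real.logb_mul (by norm_num) hs.ne'] at this
      linarith
    have h2 : Real.logb 2 x ≤ L + 1 / 2 := by
      have h14 : Real.logb 2 (7 / 5) ≤ 1 / 2 := by
        have : Real.log ((7 / 5) ^ 2) ≤ Real.log 2 :=
          Real.log_le_log (by norm_num) (by norm_num)
        rw [Real.log_pow] at this
        rw [Real.logb, div_le_iff₀ hl2]
        push_cast at this
        linarith
      have := Real.logb_le_logb_of_le one_lt_two hx0 hx'
      rw [Real.logb_mul (by norm_num) hs.ne'] at this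
      linarith
    refine ⟨some ⌊4 * Real.logb 2 x⌋, ?_, mem_geomBin_some.2 ⟨hx0, rfl⟩⟩
    simp only [Finset.mem_map, Finset.mem_Icc, Function.Embedding.some_apply, Option.some.injEq,
      exists_eq_right]
    constructor
    · rw [Int.le_floor]
      push_cast
      linarith
    · rw [← Int.lt_add_one_iff, Int.floor_lt]
      push_cast
      linarith

/-! ### Independence over disjoint blocks and the number of failing blocks. -/

section Blocks

variable {ι κ 𝒳 : Type*} [Fintype ι] [MeasurableSpace 𝒳] {P : Measure 𝒳} [IsProbabilityMeasure P]

theorem lintegral_mul_of_dependsOn {f g : (ι → 𝒳) → ℝ≥0∞} {s t : Finset ι} (hf : Measurable f)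
    (hg : Measurable g) (hfs : DependsOn f s) (hgt : DependsOn g t) (hst : Disjoint s t) :
    ∫⁻ S, f S * g S ∂(Measure.pi fun _ : ι => P) =
      (∫⁻ S, f S ∂(Measure.pi fun _ : ι => P)) * ∫⁻ S, g S ∂(Measure.pi fun _ : ι => P) := by
  classical
  have : Nonempty 𝒳 := nonempty_of_isProbabilityMeasure P
  obtain ⟨x₀⟩ := this
  -- Filling the missing coordinates with `x₀` writes `f` and `g` as functions of the restrictions
  -- to `s` and `t`, which are independent.
  let e : ∀ u : Finset ι, (u → 𝒳) → ι → 𝒳 := fun u y i => if h : i ∈ u then y ⟨i, h⟩ else x₀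
  have he : ∀ u, Measurable (e u) := by
    intro u
    refine measurable_pi_iff.2 fun i => ?_
    by_cases h : i ∈ u
    · simpa [e, h] using measurable_pi_apply _
    · simp [e, h]
  have hind : iIndepFun (fun (i : ι) (S : ι → 𝒳) => S i) (Measure.pi fun _ : ι => P) :=
    iIndepFun_pi (X := fun _ x => x) fun _ => aemeasurable_id
  have h := (hind.indepFun_finset s t hst fun i => measurable_pi_apply i).comp
    (hf.comp (he s)) (hg.comp (he t))
  have hf' : (f ∘ e s) ∘ (fun S (i : s) => S i) = f := by
    ext S
    refine hfs fun i hi => ?_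
    simp [e, Finset.mem_coe.1 hi]
  have hg' : (g ∘ e t) ∘ (fun S (i : t) => S i) = g := by
    ext S
    refine hgt fun i hi => ?_
    simp [e, Finset.mem_coe.1 hi]
  rw [hf', hg'] at h
  exact lintegral_mul_eq_lintegral_mul_lintegral_of_indepFun hf hg h

theorem lintegral_prod_of_dependsOn [DecidableEq κ] [DecidableEq ι] {f : κ → (ι → 𝒳) → ℝ≥0∞}
    {G : κ → Finset ι} (hf : ∀ j, Measurable (f j)) (hfG : ∀ j, DependsOn (f j) (G j))
    (hG : Pairwise fun i j => Disjoint (G i) (G j)) (s : Finset κ) :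
    ∫⁻ S, ∏ j ∈ s, f j S ∂(Measure.pi fun _ : ι => P) =
      ∏ j ∈ s, ∫⁻ S, f j S ∂(Measure.pi fun _ : ι => P) := by
  induction s using Finset.induction_on with
  | empty => simp
  | insert a s ha ih =>
    simp only [Finset.prod_insert ha]
    rw [lintegral_mul_of_dependsOn (hf a) (Finset.measurable_fun_prod s fun j _ => hf j) (hfG a)
      (t := s.biUnion G) ?_ ?_, ih]
    · intro S S' h
      refine Finset.prod_congr rfl fun j hj => hfG j fun i hi => h i ?_
      exact Finset.mem_coe.2 (Finset.mem_biUnion.2 ⟨j, hj, Finset.mem_coe.1 hi⟩)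
    · rw [Finset.disjoint_biUnion_right]
      intro j hj
      exact hG (by rintro rfl; exact ha hj)

-- Chernoff bound with parameter `1`: as `e ≤ 3`, the exponential moment of each indicator is at
-- most `1 + 2q ≤ exp (2q)`.
open Classical in
theorem measure_card_events_ge_le [Fintype κ] {E : κ → Set (ι → 𝒳)} {G : κ → Finset ι}
    (hE : ∀ j, MeasurableSet (E j)) (hEG : ∀ j, DependsOn (fun S => S ∈ E j) (G j))
    (hG : Pairwise fun i j => Disjoint (G i) (G j)) {q : ℝ} (hq : 0 ≤ q)
    (hPE : ∀ j, (Measure.pi fun _ : ι => P) (E j) ≤ ENNReal.ofReal q) (m : ℝ) :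
    (Measure.pi fun _ : ι => P) {S | m ≤ (Finset.univ.filter fun j => S ∈ E j).card} ≤
      ENNReal.ofReal (Real.exp (2 * (Fintype.card κ * q) - m)) := by
  set μ := Measure.pi fun _ : ι => P with hμ
  let f : κ → (ι → 𝒳) → ℝ≥0∞ := fun j S => if S ∈ E j then ENNReal.ofReal (Real.exp 1) else 1
  have hf : ∀ j, Measurable (f j) := fun j => Measurable.ite (hE j) measurable_const measurable_const
  have hfG : ∀ j, DependsOn (f j) (G j) := by
    intro j S S' h
    have := hEG j h
    simp only [f]
    rw [show (S ∈ E j) = (S' ∈ E j) from this]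
  have hfint : ∀ j, ∫⁻ S, f j S ∂μ ≤ ENNReal.ofReal (Real.exp (2 * q)) := by
    intro j
    calc ∫⁻ S, f j S ∂μ ≤ ∫⁻ S, 1 + (E j).indicator (fun _ => 2) S ∂μ := by
          refine lintegral_mono fun S => ?_
          by_cases h : S ∈ E j
          · simp only [f, h, if_true, Set.indicator_of_mem]
            have : Real.exp 1 ≤ 3 := by linarith [Real.exp_one_lt_d9]
            calc ENNReal.ofReal (Real.exp 1) ≤ ENNReal.ofReal 3 := ENNReal.ofReal_le_ofReal this
              _ = 1 + 2 := by norm_num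
          · simp [f, h]
      _ = 1 + 2 * μ (E j) := by
          rw [lintegral_add_left measurable_const, lintegral_indicator_const (hE j)]
          simp
      _ ≤ 1 + 2 * ENNReal.ofReal q := by gcongr; exact hPE j
      _ = ENNReal.ofReal (1 + 2 * q) := by
          rw [ENNReal.ofReal_add zero_le_one (by positivity), ENNReal.ofReal_mul two_pos.le]
          norm_num
      _ ≤ _ := ENNReal.ofReal_le_ofReal (by linarith [Real.add_one_le_exp (2 * q)])
  have hprod : ∀ S, ∏ j, f j S =
      ENNReal.ofReal (Real.exp ((Finset.univ.filter fun j => S ∈ E j).card)) := by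
    intro S
    simp only [f]
    rw [Finset.prod_ite, Finset.prod_const, Finset.prod_const_one, mul_one,
      ← ENNReal.ofReal_pow (Real.exp_pos _).le, ← Real.exp_nat_mul, mul_one]
  have hmarkov := mul_meas_ge_le_lintegral (μ := μ)
    (Finset.measurable_fun_prod Finset.univ fun j _ => hf j) (ENNReal.ofReal (Real.exp m))
  have hset : {S | m ≤ ((Finset.univ.filter fun j => S ∈ E j).card : ℝ)} =
      {S | ENNReal.ofReal (Real.exp m) ≤ ∏ j, f j S} := by
    ext S
    simp only [Set.mem_ofPred_eq, hprod]
    rw [ENNReal.ofReal_le_ofReal_iff (Real.exp_pos _).le, Real.exp_le_exp]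
  rw [hset, sub_eq_add_neg, Real.exp_add, ENNReal.ofReal_mul (Real.exp_pos _).le, Real.exp_neg,
    ENNReal.ofReal_inv_of_pos (Real.exp_pos _), ← div_eq_mul_inv,
    ENNReal.le_div_iff_mul_le (Or.inl (by simp [Real.exp_pos])) (Or.inl ENNReal.ofReal_ne_top),
    mul_comm]
  refine hmarkov.trans ?_
  rw [lintegral_prod_of_dependsOn hf hfG hG]
  calc ∏ j, ∫⁻ S, f j S ∂μ ≤ ∏ _j : κ, ENNReal.ofReal (Real.exp (2 * q)) :=
        Finset.prod_le_prod' fun j _ => hfint j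
    _ = ENNReal.ofReal (Real.exp (2 * (Fintype.card κ * q))) := by
        rw [Finset.prod_const, ← ENNReal.ofReal_pow (Real.exp_pos _).le, ← Real.exp_nat_mul,
          Finset.card_univ]
        congr 2
        ring

end Blocks

/-! ### Nets of the unit sphere and uniform lower bounds. -/

section Net

variable {E : Type*} [NormedAddCommGroup E] [NormedSpace ℝ E] [FiniteDimensional ℝ E]

/-- Volume comparison: disjoint balls of radius `1/200` fit into the ball of radius `201/200`. Any
norm is allowed; the sup norm of a product is used later. -/
theorem card_le_of_separated_sphere (s : Finset E) (hs : ∀ x ∈ s, ‖x‖ = 1)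
    (h : ∀ x ∈ s, ∀ y ∈ s, x ≠ y → 1 / 100 ≤ ‖x - y‖) :
    s.card ≤ 201 ^ Module.finrank ℝ E := by
  borelize E
  let μ : Measure E := Measure.addHaar
  have hdisj : (s : Set E).PairwiseDisjoint fun x => Metric.ball x (1 / 200) := by
    intro x hx y hy hxy
    apply Metric.ball_disjoint_ball
    rw [dist_eq_norm]
    have := h x hx y hy hxy
    linarith
  have hsub : ⋃ x ∈ s, Metric.ball x (1 / 200) ⊆ Metric.ball (0 : E) (201 / 200) := by
    refine Set.iUnion₂_subset fun x hx => Metric.ball_subset_ball' ?_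
    rw [dist_zero_right, hs x hx]
    norm_num
  have hI : (s.card : ℝ≥0∞) * ENNReal.ofReal ((1 / 200) ^ Module.finrank ℝ E) *
      μ (Metric.ball 0 1) ≤
      ENNReal.ofReal ((201 / 200) ^ Module.finrank ℝ E) * μ (Metric.ball 0 1) := by
    have := measure_mono (μ := μ) hsub
    rw [measure_biUnion_finset hdisj fun _ _ => measurableSet_ball] at this
    simpa only [μ.addHaar_ball_of_pos _ (show (0 : ℝ) < 1 / 200 by norm_num),
      μ.addHaar_ball_of_pos _ (show (0 : ℝ) < 201 / 200 by norm_num), Finset.sum_const,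
      nsmul_eq_mul, mul_assoc] using this
  have hJ := (ENNReal.mul_le_mul_iff_left
    (Metric.measure_ball_pos μ (0 : E) zero_lt_one).ne' measure_ball_lt_top.ne).1 hI
  have hK := ENNReal.toReal_le_of_le_ofReal (by positivity) hJ
  rw [ENNReal.toReal_mul, ENNReal.toReal_natCast, ENNReal.toReal_ofReal (by positivity),
    div_pow, div_pow, one_pow, mul_one_div, div_le_div_iff_of_pos_right (by positivity)] at hK
  exact_mod_cast hK

theorem exists_net_sphere (E : Type*) [NormedAddCommGroup E] [NormedSpace ℝ E]
    [FiniteDimensional ℝ E] :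
    ∃ t : Finset E, t.card ≤ 201 ^ Module.finrank ℝ E ∧ (∀ w ∈ t, ‖w‖ = 1) ∧
      ∀ v : E, ‖v‖ = 1 → ∃ w ∈ t, ‖v - w‖ ≤ 1 / 100 := by
  classical
  let A : Set E := Metric.sphere 0 1
  let e : ℝ≥0 := 1 / 100
  have hcoe : ∀ x y : E, (e : ℝ≥0∞) < edist x y → 1 / 100 ≤ ‖x - y‖ := by
    intro x y hxy
    rw [edist_nndist, ENNReal.coe_lt_coe, ← NNReal.coe_lt_coe, coe_nndist, dist_eq_norm] at hxy
    simpa [e] using hxy.le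
  have hpack : Metric.packingNumber e A ≤ (201 ^ Module.finrank ℝ E : ℕ) := by
    refine iSup_le fun C => iSup_le fun hCA => iSup_le fun hC => ?_
    by_contra! hlt
    obtain ⟨C', hC'C, hC'⟩ := Set.exists_subset_encard_eq (Order.add_one_le_of_lt hlt)
    have hfin : C'.Finite := Set.finite_of_encard_eq_coe (k := 201 ^ Module.finrank ℝ E + 1)
      (by rw [hC']; norm_cast)
    have := card_le_of_separated_sphere hfin.toFinset
      (fun x hx => by simpa [A] using hCA (hC'C (by simpa using hx)))
      (fun x hx y hy hxy => hcoe x y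
        (hC (hC'C (by simpa using hx)) (hC'C (by simpa using hy)) hxy))
    rw [hfin.encard_eq_coe_toFinset_card] at hC'
    have h2 : hfin.toFinset.card = 201 ^ Module.finrank ℝ E + 1 := by exact_mod_cast hC'
    lia
  have htop : Metric.packingNumber e A ≠ ⊤ := ne_top_of_le_ne_top (ENat.natCast_ne_top _) hpack
  have hcard := (Metric.encard_maximalSeparatedSet htop).trans_le hpack
  have hfin : (Metric.maximalSeparatedSet e A).Finite := Set.finite_of_encard_le_coe hcard
  refine ⟨hfin.toFinset, ?_, fun w hw => ?_, fun v hv => ?_⟩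
  · rw [hfin.encard_eq_coe_toFinset_card] at hcard
    exact_mod_cast hcard
  · simpa [A] using Metric.maximalSeparatedSet_subset (hfin.mem_toFinset.1 hw)
  · obtain ⟨w, hw, hvw⟩ := Metric.isCover_maximalSeparatedSet htop
      (show v ∈ A by simpa [A] using hv)
    refine ⟨w, hfin.mem_toFinset.2 hw, ?_⟩
    have hvw' : edist v w ≤ e := hvw
    rw [edist_nndist, ENNReal.coe_le_coe, ← NNReal.coe_le_coe, coe_nndist, dist_eq_norm] at hvw'
    simpa [e] using hvw'

theorem norm_le_of_net {E : Type*} [NormedAddCommGroup E] [NormedSpace ℝ E]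
    {F : Type*} [NormedAddCommGroup F] [NormedSpace ℝ F] (L : E →L[ℝ] F)
    {t : Finset E} (ht : ∀ v : E, ‖v‖ = 1 → ∃ w ∈ t, ‖v - w‖ ≤ 1 / 100) {c T : ℝ} (hT : 0 ≤ T)
    (hle : ∀ w ∈ t, ‖L w‖ ≤ T) (hge : ∀ w ∈ t, c ≤ ‖L w‖) (v : E) :
    (c - T / 99) * ‖v‖ ≤ ‖L v‖ := by
  -- Self-bounding: this gives `‖L‖ ≤ 100 T / 99`, so moving to the nearest net point changes `‖L
  -- x‖` by at most `T / 99`.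
  have hL : ‖L‖ ≤ T + ‖L‖ / 100 := by
    refine ContinuousLinearMap.opNorm_le_of_unit_norm (by positivity) fun x hx => ?_
    obtain ⟨w, hw, hxw⟩ := ht x hx
    have h1 : ‖L x‖ ≤ ‖L w‖ + ‖L (x - w)‖ := by
      calc ‖L x‖ = ‖L w + L (x - w)‖ := by rw [map_sub]; congr 1; abel
        _ ≤ _ := norm_add_le _ _
    have h2 := L.le_opNorm (x - w)
    have h3 := hle w hw
    nlinarith [norm_nonneg L]
  have hunit : ∀ x : E, ‖x‖ = 1 → c - T / 99 ≤ ‖L x‖ := by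
    intro x hx
    obtain ⟨w, hw, hxw⟩ := ht x hx
    have h1 : ‖L w‖ ≤ ‖L x‖ + ‖L (x - w)‖ := by
      calc ‖L w‖ = ‖L x - L (x - w)‖ := by rw [map_sub]; congr 1; abel
        _ ≤ _ := norm_sub_le _ _
    have h2 := L.le_opNorm (x - w)
    have h3 := hge w hw
    nlinarith [norm_nonneg L]
  rcases eq_or_ne v 0 with rfl | hv
  · simp
  · have hv' : 0 < ‖v‖ := norm_pos_iff.2 hv
    have := hunit (‖v‖⁻¹ • v) (by rw [norm_smul, norm_inv, norm_norm, inv_mul_cancel₀ hv'.ne'])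
    rw [map_smul, norm_smul, norm_inv, norm_norm, inv_mul_eq_div, le_div_iff₀ hv'] at this
    exact this

theorem sum_sq_ge_of_net {ι : Type*} (G : Finset ι) (W : ι → E →ₗ[ℝ] ℝ) {t : Finset E}
    (ht : ∀ v : E, ‖v‖ = 1 → ∃ w ∈ t, ‖v - w‖ ≤ 1 / 100)
    (hle : ∀ w ∈ t, ∑ i ∈ G, (W i w) ^ 2 ≤ 16 * G.card)
    (hge : ∀ w ∈ t, 24 / 25 * (G.card : ℝ) ≤ ∑ i ∈ G, (W i w) ^ 2) (v : E) :
    17 / 20 * G.card * ‖v‖ ^ 2 ≤ ∑ i ∈ G, (W i v) ^ 2 := by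
  let L₀ : E →ₗ[ℝ] EuclideanSpace ℝ G :=
    { toFun := fun v => WithLp.toLp 2 fun i : G => W i v
      map_add' := fun x y => by ext i; simp
      map_smul' := fun r x => by ext i; simp }
  let L : E →L[ℝ] EuclideanSpace ℝ G := L₀.toContinuousLinearMap
  have hL : ∀ x, ‖L x‖ ^ 2 = ∑ i ∈ G, (W i x) ^ 2 := by
    intro x
    rw [EuclideanSpace.real_norm_sq_eq, ← Finset.sum_coe_sort G]
    rfl
  set b : ℝ := √G.card with hb
  have hb0 : 0 ≤ b := Real.sqrt_nonneg _
  have hb2 : b ^ 2 = G.card := Real.sq_sqrt (Nat.cast_nonneg _)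
  -- `(979/1000)² ≤ 24/25`, and `(979/1000 - 4/99)² ≥ 17/20`.
  have key := norm_le_of_net L ht (c := 979 / 1000 * b) (T := 4 * b) (by positivity)
    (fun w hw => abs_le_of_sq_le_sq' (by rw [hL]; nlinarith [hle w hw]) (by positivity) |>.2)
    (fun w hw => abs_le_of_sq_le_sq' (by rw [hL]; nlinarith [hge w hw]) (by positivity) |>.2) v
  have h0 : 0 ≤ (979 / 1000 * b - 4 * b / 99) * ‖v‖ :=
    mul_nonneg (by linarith) (norm_nonneg _)
  have h2 := pow_le_pow_left₀ h0 key 2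
  rw [hL, mul_pow] at h2
  refine le_trans ?_ h2
  gcongr
  rw [← hb2]
  nlinarith [sq_nonneg b]

end Net

/-! ### Chernoff bounds for sums of squares. -/

section Chernoff

variable {ι 𝒳 : Type*} [Fintype ι] [MeasurableSpace 𝒳] {P : Measure 𝒳} [IsProbabilityMeasure P]

theorem measure_sum_ge_le {f : 𝒳 → ℝ} (hf : Measurable f) {r : ℝ}
    (hr : ∫⁻ x, ENNReal.ofReal (Real.exp (f x)) ∂P ≤ ENNReal.ofReal (Real.exp r)) (G : Finset ι)
    (c : ℝ) :
    (Measure.pi fun _ : ι => P) {S | G.card * c ≤ ∑ i ∈ G, f (S i)} ≤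
      ENNReal.ofReal (Real.exp (G.card * (r - c))) := by
  classical
  set μ := Measure.pi fun _ : ι => P
  have hF : ∀ i : ι, Measurable fun S : ι → 𝒳 => ENNReal.ofReal (Real.exp (f (S i))) :=
    fun i => by fun_prop
  have hmarkov := mul_meas_ge_le_lintegral (μ := μ)
    (Finset.measurable_fun_prod G fun i _ => hF i) (ENNReal.ofReal (Real.exp (G.card * c)))
  have hset : {S : ι → 𝒳 | G.card * c ≤ ∑ i ∈ G, f (S i)} =
      {S | ENNReal.ofReal (Real.exp (G.card * c)) ≤
        ∏ i ∈ G, ENNReal.ofReal (Real.exp (f (S i)))} := by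
    ext S
    simp only [Set.mem_ofPred_eq]
    rw [← ENNReal.ofReal_prod_of_nonneg fun i _ => (Real.exp_pos _).le, ← Real.exp_sum,
      ENNReal.ofReal_le_ofReal_iff (Real.exp_pos _).le, Real.exp_le_exp]
  rw [hset, mul_sub, sub_eq_add_neg, Real.exp_add, ENNReal.ofReal_mul (Real.exp_pos _).le,
    Real.exp_neg, ENNReal.ofReal_inv_of_pos (Real.exp_pos _), ← div_eq_mul_inv,
    ENNReal.le_div_iff_mul_le (Or.inl (by simp [Real.exp_pos])) (Or.inl ENNReal.ofReal_ne_top),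
    mul_comm]
  refine hmarkov.trans ?_
  rw [lintegral_prod_of_dependsOn (G := fun i : ι => {i}) hF
    (fun i S S' h => by simp only [h i (by simp)])
    (fun i j hij => Finset.disjoint_singleton.2 hij)]
  have hi : ∀ i : ι, ∫⁻ S, ENNReal.ofReal (Real.exp (f (S i))) ∂μ ≤ ENNReal.ofReal (Real.exp r) := by
    intro i
    refine le_trans (le_of_eq ?_) hr
    exact (measurePreserving_eval (fun _ : ι => P) i).lintegral_comp
      (f := fun x => ENNReal.ofReal (Real.exp (f x))) (by fun_prop)
  calc ∏ i ∈ G, ∫⁻ S, ENNReal.ofReal (Real.exp (f (S i))) ∂μ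
      ≤ ∏ _i ∈ G, ENNReal.ofReal (Real.exp r) := Finset.prod_le_prod' fun i _ => hi i
    _ = ENNReal.ofReal (Real.exp (G.card * r)) := by
      rw [Finset.prod_const, ← ENNReal.ofReal_pow (Real.exp_pos _).le, ← Real.exp_nat_mul]

/-- Lower-tail exponential moment from `exp (-u) ≤ 1 - u + u²/2` at `u = g²/25600`, the quadratic
term being absorbed by `exp (g²/16)`. Integrating gives `1 - 1/25600 + 512/25600² = 1 - 49/1280000`.
-/
theorem lintegral_exp_neg_sq_le {g : 𝒳 → ℝ} (hg : Measurable g) (h1 : 1 ≤ ∫ x, g x ^ 2 ∂P)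
    (h2 : ∫⁻ x, ENNReal.ofReal (Real.exp (g x ^ 2 / 16)) ∂P ≤ 2) :
    ∫⁻ x, ENNReal.ofReal (Real.exp (-(g x ^ 2 / 25600))) ∂P ≤
      ENNReal.ofReal (Real.exp (-(49 / 1280000))) := by
  have hexp : Integrable (fun x => Real.exp (g x ^ 2 / 16)) P := by
    refine ⟨by fun_prop, ?_⟩
    rw [hasFiniteIntegral_iff_ofReal (Filter.Eventually.of_forall fun x => (Real.exp_pos _).le)]
    exact h2.trans_lt (by norm_num)
  have hsq : Integrable (fun x => g x ^ 2) P := by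
    refine (hexp.const_mul 16).mono' (by fun_prop) (Filter.Eventually.of_forall fun x => ?_)
    rw [Real.norm_of_nonneg (sq_nonneg _)]
    linarith [Real.add_one_le_exp (g x ^ 2 / 16)]
  have hexp2 : ∫ x, Real.exp (g x ^ 2 / 16) ∂P ≤ 2 := by
    rw [integral_eq_lintegral_of_nonneg_ae
      (Filter.Eventually.of_forall fun x => (Real.exp_pos _).le) (by fun_prop)]
    exact ENNReal.toReal_le_of_le_ofReal zero_le_two (by simpa using h2)
  have hpt : ∀ x, Real.exp (-(g x ^ 2 / 25600)) ≤
      1 - g x ^ 2 / 25600 + Real.exp (g x ^ 2 / 16) * (256 / 25600 ^ 2) := by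
    intro x
    set y := g x ^ 2 with hy
    have hy0 : 0 ≤ y := sq_nonneg _
    have hq := Real.quadratic_le_exp_of_nonneg (show 0 ≤ y / 16 by positivity)
    have hu : 0 ≤ y / 25600 := by positivity
    have hn : Real.exp (-(y / 25600)) ≤ 1 - y / 25600 + (y / 25600) ^ 2 / 2 := by
      have h := Real.quadratic_le_exp_of_nonneg hu
      rw [Real.exp_neg, inv_le_comm₀ (Real.exp_pos _) (by nlinarith)]
      refine le_trans ?_ h
      rw [inv_le_iff_one_le_mul₀ (by nlinarith)]
      nlinarith [sq_nonneg ((y / 25600) ^ 2)]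
    nlinarith
  rw [← ofReal_integral_eq_lintegral_ofReal
    ((integrable_const (1 : ℝ)).mono' (by fun_prop) (Filter.Eventually.of_forall fun x => by
      rw [Real.norm_of_nonneg (Real.exp_pos _).le, Real.exp_le_one_iff]
      simp only [Left.neg_nonpos_iff]
      positivity))
    (Filter.Eventually.of_forall fun x => (Real.exp_pos _).le)]
  refine ENNReal.ofReal_le_ofReal ?_
  have hsub : Integrable (fun x => 1 - g x ^ 2 / 25600) P :=
    (integrable_const _).sub (hsq.div_const _)
  calc ∫ x, Real.exp (-(g x ^ 2 / 25600)) ∂P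
      ≤ ∫ x, (1 - g x ^ 2 / 25600 + Real.exp (g x ^ 2 / 16) * (256 / 25600 ^ 2)) ∂P := by
        refine integral_mono_of_nonneg (Filter.Eventually.of_forall fun x => (Real.exp_pos _).le)
          ?_ (Filter.Eventually.of_forall hpt)
        exact hsub.add (hexp.mul_const _)
    _ = 1 - (∫ x, g x ^ 2 ∂P) / 25600 +
          (∫ x, Real.exp (g x ^ 2 / 16) ∂P) * (256 / 25600 ^ 2) := by
        rw [integral_add hsub (hexp.mul_const _),
          integral_sub (integrable_const _) (hsq.div_const _), integral_div, integral_mul_const]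
        simp
    _ ≤ -(49 / 1280000) + 1 := by nlinarith
    _ ≤ _ := Real.add_one_le_exp _

theorem log_two_sub_one_le : Real.log 2 - 1 ≤ -(1 / 1280000) := by
  linarith [Real.log_two_lt_d9]

theorem exists_event_sum_sq_ge {E : Type*} [NormedAddCommGroup E] [NormedSpace ℝ E]
    [FiniteDimensional ℝ E] {W : 𝒳 → E →ₗ[ℝ] ℝ} (hW : ∀ v, Measurable fun x => W x v)
    (h1 : ∀ v, ‖v‖ = 1 → 1 ≤ ∫ x, W x v ^ 2 ∂P)
    (h2 : ∀ v, ‖v‖ = 1 → ∫⁻ x, ENNReal.ofReal (Real.exp (W x v ^ 2 / 16)) ∂P ≤ 2)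
    (G : Finset ι) :
    ∃ A : Set (ι → 𝒳), MeasurableSet A ∧ DependsOn (fun S => S ∈ A) (G : Set ι) ∧
      (Measure.pi fun _ : ι => P) A ≤ ENNReal.ofReal
        (2 * 201 ^ Module.finrank ℝ E * Real.exp (-(G.card / 1280000))) ∧
      ∀ S, S ∉ A → ∀ v, 17 / 20 * G.card * ‖v‖ ^ 2 ≤ ∑ i ∈ G, (W (S i) v) ^ 2 := by
  obtain ⟨t, htcard, htnorm, ht⟩ := exists_net_sphere E
  set μ := Measure.pi fun _ : ι => P
  let U : E → Set (ι → 𝒳) := fun w => {S | G.card * (1 : ℝ) ≤ ∑ i ∈ G, W (S i) w ^ 2 / 16}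
  -- `48/1280000` is `24/25` of `1/25600`, so `V w` is the event that the sum of squares is at most
  -- `24/25` of `G.card`; it leaves a margin of `1/1280000` per sample below the rate `49/1280000`.
  let V : E → Set (ι → 𝒳) := fun w =>
    {S | G.card * (-(48 / 1280000) : ℝ) ≤ ∑ i ∈ G, -(W (S i) w ^ 2 / 25600)}
  have hU : ∀ w ∈ t, μ (U w) ≤ ENNReal.ofReal (Real.exp (-(G.card / 1280000))) := by
    intro w hw
    refine (measure_sum_ge_le (f := fun x => W x w ^ 2 / 16) (((hW w).pow_const 2).div_const 16)
      (r := Real.log 2) ?_ G 1).trans (ENNReal.ofReal_le_ofReal (Real.exp_le_exp.2 ?_))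
    · rw [Real.exp_log two_pos]
      simpa using h2 w (htnorm w hw)
    · have := mul_le_mul_of_nonneg_left log_two_sub_one_le (Nat.cast_nonneg (α := ℝ) G.card)
      linarith
  have hV : ∀ w ∈ t, μ (V w) ≤ ENNReal.ofReal (Real.exp (-(G.card / 1280000))) := by
    intro w hw
    refine (measure_sum_ge_le (f := fun x => -(W x w ^ 2 / 25600))
      (((hW w).pow_const 2).div_const 25600).neg (r := -(49 / 1280000))
      (lintegral_exp_neg_sq_le (hW w) (h1 w (htnorm w hw)) (h2 w (htnorm w hw)))
      G _).trans (ENNReal.ofReal_le_ofReal (Real.exp_le_exp.2 ?_))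
    linarith
  refine ⟨⋃ w ∈ t, (U w ∪ V w), ?_, ?_, ?_, ?_⟩
  · refine t.measurableSet_biUnion fun w _ => MeasurableSet.union ?_ ?_
    · exact measurableSet_le measurable_const (Finset.measurable_fun_sum G fun i _ =>
        (((hW w).comp (measurable_pi_apply i)).pow_const 2).div_const 16)
    · exact measurableSet_le measurable_const (Finset.measurable_fun_sum G fun i _ =>
        ((((hW w).comp (measurable_pi_apply i)).pow_const 2).div_const 25600).neg)
  · intro S S' h
    have h' : ∀ (w : E) (F : ℝ → ℝ), ∑ i ∈ G, F (W (S i) w) = ∑ i ∈ G, F (W (S' i) w) :=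
      fun w F => Finset.sum_congr rfl fun i hi => by rw [h i (Finset.mem_coe.2 hi)]
    simp only [Set.mem_iUnion, U, V, Set.mem_union, Set.mem_ofPred_eq, h' _ fun x => x ^ 2 / 16,
      h' _ fun x => -(x ^ 2 / 25600)]
  · refine (measure_biUnion_finset_le _ _).trans ?_
    calc ∑ w ∈ t, μ (U w ∪ V w)
        ≤ ∑ w ∈ t, ENNReal.ofReal (2 * Real.exp (-(G.card / 1280000))) := by
          refine Finset.sum_le_sum fun w hw => (measure_union_le _ _).trans ?_
          rw [two_mul, ENNReal.ofReal_add (Real.exp_pos _).le (Real.exp_pos _).le]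
          exact add_le_add (hU w hw) (hV w hw)
      _ = ENNReal.ofReal (t.card * (2 * Real.exp (-(G.card / 1280000)))) := by
          rw [ENNReal.ofReal_mul (Nat.cast_nonneg _), ENNReal.ofReal_natCast]
          simp
      _ ≤ _ := by
          refine ENNReal.ofReal_le_ofReal ?_
          have : (t.card : ℝ) ≤ 201 ^ Module.finrank ℝ E := by exact_mod_cast htcard
          nlinarith [Real.exp_pos (-((G.card : ℝ) / 1280000))]
  · intro S hS v
    simp only [Set.mem_iUnion, U, V, Set.mem_union, Set.mem_ofPred_eq, not_exists, not_or,
      not_le] at hS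
    refine sum_sq_ge_of_net G (fun i => W (S i)) ht (fun w hw => ?_) (fun w hw => ?_) v
    · have := (hS w hw).1
      rw [← Finset.sum_div] at this
      linarith
    · have := (hS w hw).2
      rw [Finset.sum_neg_distrib, ← Finset.sum_div] at this
      linarith

end Chernoff

/-! ### Exponential moments of squared Gaussians. -/

theorem lintegral_exp_mul_sq_gaussianReal {t : ℝ} (ht : t < 1 / 2) :
    ∫⁻ x, ENNReal.ofReal (Real.exp (t * x ^ 2)) ∂(gaussianReal 0 1) =
      ENNReal.ofReal (√(1 / (1 - 2 * t))) := by
  have hb : 0 < 1 / 2 - t := by linarith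
  rw [gaussianReal_of_var_ne_zero 0 one_ne_zero,
    lintegral_withDensity_eq_lintegral_mul _ (measurable_gaussianPDF 0 1) (by fun_prop)]
  have hpt : ∀ x : ℝ, (gaussianPDF 0 1 * fun x => ENNReal.ofReal (Real.exp (t * x ^ 2))) x =
      ENNReal.ofReal ((√(2 * Real.pi))⁻¹ * Real.exp (-(1 / 2 - t) * x ^ 2)) := by
    intro x
    rw [Pi.mul_apply, gaussianPDF, gaussianPDFReal, ← ENNReal.ofReal_mul (by positivity),
      mul_assoc, ← Real.exp_add]
    congr 3
    · simp
    · push_cast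
      ring
  rw [lintegral_congr hpt, ← ofReal_integral_eq_lintegral_ofReal
    ((integrable_exp_neg_mul_sq hb).const_mul _)
    (Filter.Eventually.of_forall fun x => by positivity), integral_const_mul, integral_gaussian,
    ← Real.sqrt_inv, ← Real.sqrt_mul (by positivity)]
  congr 2
  have : 1 - 2 * t ≠ 0 := by linarith
  have := hb.ne'
  field_simp

theorem lintegral_exp_sq_div_four_gaussianReal_le {v : ℝ≥0} (hv : v ≤ 1) :
    ∫⁻ x, ENNReal.ofReal (Real.exp (x ^ 2 / 4)) ∂(gaussianReal 0 v) ≤ ENNReal.ofReal √2 := by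
  have hmap : gaussianReal 0 v = (gaussianReal 0 1).map (√(v : ℝ) * ·) := by
    rw [gaussianReal_map_const_mul]
    congr 1
    · simp
    · ext; simp
  rw [hmap, lintegral_map (by fun_prop) (by fun_prop)]
  have h := lintegral_exp_mul_sq_gaussianReal (t := 1 / 4) (by norm_num)
  rw [show (1 : ℝ) / (1 - 2 * (1 / 4)) = 2 by norm_num] at h
  rw [← h]
  refine lintegral_mono fun x => ENNReal.ofReal_le_ofReal (Real.exp_le_exp.2 ?_)
  rw [mul_pow, Real.sq_sqrt v.coe_nonneg]
  have : (v : ℝ) ≤ 1 := by exact_mod_cast hv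
  nlinarith [sq_nonneg x]

/-- No joint law is assumed: `(f + g)² ≤ 2f² + 2g²` and AM-GM separate the two variables. -/
theorem lintegral_exp_add_sq_le {𝒳 : Type*} [MeasurableSpace 𝒳] {P : Measure 𝒳} {f g : 𝒳 → ℝ}
    (hf : Measurable f) (hg : Measurable g) {v w : ℝ≥0} (hv : v ≤ 1) (hw : w ≤ 1)
    (hfv : P.map f = gaussianReal 0 v) (hgw : P.map g = gaussianReal 0 w) :
    ∫⁻ x, ENNReal.ofReal (Real.exp ((f x + g x) ^ 2 / 16)) ∂P ≤ 2 := by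
  have hb : ∀ {h : 𝒳 → ℝ} {v : ℝ≥0}, Measurable h → v ≤ 1 → P.map h = gaussianReal 0 v →
      ∫⁻ x, ENNReal.ofReal (Real.exp (h x ^ 2 / 4)) ∂P ≤ ENNReal.ofReal √2 := by
    intro h v hh hv hmap
    rw [← lintegral_map (f := fun y => ENNReal.ofReal (Real.exp (y ^ 2 / 4))) (by fun_prop) hh,
      hmap]
    exact lintegral_exp_sq_div_four_gaussianReal_le hv
  calc ∫⁻ x, ENNReal.ofReal (Real.exp ((f x + g x) ^ 2 / 16)) ∂P
      ≤ ∫⁻ x, 2⁻¹ * (ENNReal.ofReal (Real.exp (f x ^ 2 / 4)) +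
          ENNReal.ofReal (Real.exp (g x ^ 2 / 4))) ∂P := by
        refine lintegral_mono fun x => ?_
        rw [← ENNReal.ofReal_add (Real.exp_pos _).le (Real.exp_pos _).le,
          show (2⁻¹ : ℝ≥0∞) = ENNReal.ofReal (1 / 2) by
            rw [one_div, ENNReal.ofReal_inv_of_pos two_pos]; norm_num,
          ← ENNReal.ofReal_mul (by norm_num)]
        refine ENNReal.ofReal_le_ofReal ?_
        set p := Real.exp (f x ^ 2 / 8) with hp
        set q := Real.exp (g x ^ 2 / 8) with hq
        have hp2 : Real.exp (f x ^ 2 / 4) = p ^ 2 := by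
          rw [hp, ← Real.exp_nat_mul]; congr 1; push_cast; ring
        have hq2 : Real.exp (g x ^ 2 / 4) = q ^ 2 := by
          rw [hq, ← Real.exp_nat_mul]; congr 1; push_cast; ring
        have h1 : Real.exp ((f x + g x) ^ 2 / 16) ≤ p * q := by
          rw [hp, hq, ← Real.exp_add]
          exact Real.exp_le_exp.2 (by nlinarith [sq_nonneg (f x - g x)])
        rw [hp2, hq2]
        nlinarith [sq_nonneg (p - q)]
    _ = 2⁻¹ * (∫⁻ x, ENNReal.ofReal (Real.exp (f x ^ 2 / 4)) ∂P +
          ∫⁻ x, ENNReal.ofReal (Real.exp (g x ^ 2 / 4)) ∂P) := by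
        rw [lintegral_const_mul _ (by fun_prop), lintegral_add_left (by fun_prop)]
    _ ≤ 2⁻¹ * (ENNReal.ofReal 2 + ENNReal.ofReal 2) := by
        have h2 : ENNReal.ofReal √2 ≤ ENNReal.ofReal 2 :=
          ENNReal.ofReal_le_ofReal (Real.sqrt_le_iff.2 (by norm_num))
        gcongr
        · exact (hb hf hv hfv).trans h2
        · exact (hb hg hw hgw).trans h2
    _ = 2 := by
        rw [← two_mul, ← mul_assoc, ENNReal.inv_mul_cancel (by norm_num) (by norm_num)]
        norm_num

theorem measure_sum_sq_gaussian_ge_le {ι 𝒳 : Type*} [Fintype ι] [MeasurableSpace 𝒳]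
    {P : Measure 𝒳} [IsProbabilityMeasure P] {f : 𝒳 → ℝ} (hf : Measurable f)
    (hlaw : P.map f = gaussianReal 0 1) (G : Finset ι) :
    (Measure.pi fun _ : ι => P) {S | 7 / 5 * (G.card : ℝ) ≤ ∑ i ∈ G, f (S i) ^ 2} ≤
      ENNReal.ofReal (Real.exp (-(G.card / 1280000))) := by
  have hexp : ∫⁻ x, ENNReal.ofReal (Real.exp (f x ^ 2 / 8)) ∂P ≤
      ENNReal.ofReal (Real.exp (3 / 20)) := by
    rw [← lintegral_map (f := fun y => ENNReal.ofReal (Real.exp (y ^ 2 / 8))) (by fun_prop) hf,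
      hlaw]
    have h := lintegral_exp_mul_sq_gaussianReal (t := 1 / 8) (by norm_num)
    simp only [one_div_mul_eq_div] at h
    rw [h]
    refine ENNReal.ofReal_le_ofReal (Real.sqrt_le_iff.2 ⟨(Real.exp_pos _).le, ?_⟩)
    rw [← Real.exp_nat_mul]
    -- The moment is `√(4/3)`, and `4/3 ≤ 1 + 3/10 + (3/10)²/2`.
    refine le_trans ?_ (Real.quadratic_le_exp_of_nonneg (by norm_num))
    norm_num
  have hset : {S : ι → 𝒳 | 7 / 5 * (G.card : ℝ) ≤ ∑ i ∈ G, f (S i) ^ 2} =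
      {S | G.card * (7 / 40 : ℝ) ≤ ∑ i ∈ G, f (S i) ^ 2 / 8} := by
    ext S
    simp only [Set.mem_ofPred_eq]
    rw [← Finset.sum_div]
    constructor <;> intro h <;> linarith
  rw [hset]
  refine (measure_sum_ge_le (f := fun x => f x ^ 2 / 8) (by fun_prop) hexp G _).trans
    (ENNReal.ofReal_le_ofReal (Real.exp_le_exp.2 ?_))
  have : (0 : ℝ) ≤ G.card := Nat.cast_nonneg _
  linarith

/-! ### Whitening and moments in the linear model. -/

-- `B` is the inverse of the square root of `M`; `N(0, M)` is the image of the standard Gaussian `g`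
-- under that root, so `⟪B u, x⟫` becomes `⟪u, g⟫`.
open scoped MatrixOrder in
theorem exists_whitening {d : ℕ} {M : Matrix (Fin d) (Fin d) ℝ} (hM : M.PosDef) :
    ∃ B : EuclideanSpace ℝ (Fin d) →ₗ[ℝ] EuclideanSpace ℝ (Fin d), Function.Surjective B ∧
      ∀ u, (multivariateGaussian 0 M).map (fun x => inner ℝ (B u) x) =
        gaussianReal 0 (‖u‖₊ ^ 2) := by
  have hunit : IsUnit (Matrix.toEuclideanCLM (n := Fin d) (𝕜 := ℝ) (CFC.sqrt M)) := by
    refine IsUnit.map _ ?_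
    have h := hM.isUnit
    rw [← CFC.sqrt_mul_sqrt_self M hM.posSemidef.nonneg] at h
    exact ((Commute.refl _).isUnit_mul_iff.1 h).1
  have hself : IsSelfAdjoint (Matrix.toEuclideanCLM (n := Fin d) (𝕜 := ℝ) (CFC.sqrt M)) :=
    (CFC.sqrt_nonneg M).isSelfAdjoint.map _
  set A := Matrix.toEuclideanCLM (n := Fin d) (𝕜 := ℝ) (CFC.sqrt M) with hA
  obtain ⟨U, hU⟩ := hunit
  set B : EuclideanSpace ℝ (Fin d) →L[ℝ] EuclideanSpace ℝ (Fin d) := ↑U⁻¹ with hB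
  have hAB : ∀ v, A (B v) = v := fun v => by
    rw [← hU, hB, ← mul_apply_eq_comp, Units.mul_inv, one_apply_eq_self]
  have hBA : ∀ v, B (A v) = v := fun v => by
    rw [← hU, hB, ← mul_apply_eq_comp, Units.inv_mul, one_apply_eq_self]
  refine ⟨B.toLinearMap, fun v => ⟨A v, hBA v⟩, fun u => ?_⟩
  rw [multivariateGaussian, Measure.map_map (by fun_prop) (by fun_prop)]
  have : (fun x => inner ℝ (B.toLinearMap u) x) ∘ (fun x => 0 + A x) = innerSL ℝ u := by
    ext x
    simp only [Function.comp_apply, zero_add, ContinuousLinearMap.coe_coe, innerSL_apply_apply]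
    rw [← ContinuousLinearMap.adjoint_inner_left, hself.adjoint_eq, hAB]
  rw [this, IsGaussian.map_eq_gaussianReal, integral_strongDual_stdGaussian,
    variance_dual_stdGaussian, innerSL_apply_norm]
  congr 1
  ext
  simp

theorem memLp_two_of_map_eq_gaussianReal {𝒳 : Type*} [MeasurableSpace 𝒳] {P : Measure 𝒳}
    {f : 𝒳 → ℝ} (hf : Measurable f) {v : ℝ≥0} (h : P.map f = gaussianReal 0 v) :
    MemLp f 2 P := by
  have := memLp_id_gaussianReal (μ := 0) (v := v) 2
  rw [← h] at this
  exact this.comp_of_map hf.aemeasurable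

theorem integral_sq_of_map_eq_gaussianReal {𝒳 : Type*} [MeasurableSpace 𝒳] {P : Measure 𝒳}
    {f : 𝒳 → ℝ} (hf : Measurable f) {v : ℝ≥0} (h : P.map f = gaussianReal 0 v) :
    ∫ x, f x ^ 2 ∂P = v := by
  rw [← integral_map (f := fun y : ℝ => y ^ 2) hf.aemeasurable (by fun_prop), h]
  have := variance_of_integral_eq_zero (X := id) (μ := gaussianReal 0 v) aemeasurable_id
    (by simp)
  rw [variance_id_gaussianReal] at this
  simpa using this.symm

namespace IsGaussianLinearModel

variable {d : ℕ} {P : Measure (EuclideanSpace ℝ (Fin d) × ℝ)}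
  {M : Matrix (Fin d) (Fin d) ℝ} {β : EuclideanSpace ℝ (Fin d)} {σ : ℝ≥0}

theorem memLp_inner (h : IsGaussianLinearModel P M β σ) (v : EuclideanSpace ℝ (Fin d)) :
    MemLp (fun q : EuclideanSpace ℝ (Fin d) × ℝ => inner ℝ v q.1) 2 P := by
  have h1 : MemLp (innerSL ℝ v) 2 (P.map Prod.fst) := by
    rw [h.law_x]
    exact IsGaussian.memLp_dual _ _ 2 (by simp)
  exact h1.comp_of_map measurable_fst.aemeasurable

theorem memLp_noise (h : IsGaussianLinearModel P M β σ) :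
    MemLp (fun q : EuclideanSpace ℝ (Fin d) × ℝ => q.2 - inner ℝ q.1 β) 2 P :=
  memLp_two_of_map_eq_gaussianReal (by fun_prop) h.law_z

theorem integral_inner_mul_inner (h : IsGaussianLinearModel P M β σ)
    (v w : EuclideanSpace ℝ (Fin d)) :
    ∫ q, inner ℝ v q.1 * inner ℝ w q.1 ∂P = v ⬝ᵥ M *ᵥ w := by
  rw [← covarianceBilin_multivariateGaussian (μ := 0) h.posDef.posSemidef,
    covarianceBilin_apply IsGaussian.memLp_two_id, integral_id_multivariateGaussian', ← h.law_x,
    integral_map measurable_fst.aemeasurable (by fun_prop)]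
  simp

/-- The normal equations `M β = 𝔼[y x]`. This orthogonality is the only relation between noise and
design used later. -/
theorem integral_noise_mul_inner (h : IsGaussianLinearModel P M β σ)
    (v : EuclideanSpace ℝ (Fin d)) :
    ∫ q, (q.2 - inner ℝ q.1 β) * inner ℝ v q.1 ∂P = 0 := by
  have hy : MemLp (fun q : EuclideanSpace ℝ (Fin d) × ℝ => q.2) 2 P := by
    have := h.memLp_noise.add (h.memLp_inner β)
    refine this.ae_eq (Filter.Eventually.of_forall fun q => ?_)
    simp [real_inner_comm]
  have hcoord : ∀ (j : Fin d) (q : EuclideanSpace ℝ (Fin d) × ℝ),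
      q.1 j = inner ℝ (EuclideanSpace.basisFun (Fin d) ℝ j) q.1 := by
    intro j q
    simp [PiLp.inner_apply]
  have hyx : ∀ j, Integrable (fun q : EuclideanSpace ℝ (Fin d) × ℝ => q.2 * q.1 j) P := by
    intro j
    simp only [hcoord]
    exact hy.integrable_mul (h.memLp_inner _)
  have hyv : ∫ q, q.2 * inner ℝ v q.1 ∂P = v ⬝ᵥ M *ᵥ β := by
    have hdet : IsUnit M.det := (Matrix.isUnit_iff_isUnit_det M).1 h.posDef.isUnit
    have hMβ : M *ᵥ β = fun j => ∫ q, q.2 * q.1 j ∂P := by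
      conv_lhs => rw [h.param]
      simp only [Matrix.mulVec_mulVec, Matrix.mul_nonsing_inv M hdet, Matrix.one_mulVec]
    rw [hMβ]
    simp only [PiLp.inner_apply, dotProduct, Finset.mul_sum, ← integral_const_mul]
    rw [integral_finsetSum _ (fun j _ => ?_)]
    · refine Finset.sum_congr rfl fun j _ => integral_congr_ae
        (Filter.Eventually.of_forall fun q => ?_)
      simp
      ring
    · refine ((hyx j).const_mul (v j)).congr (Filter.Eventually.of_forall fun q => ?_)
      simp
      ring
  calc ∫ q, (q.2 - inner ℝ q.1 β) * inner ℝ v q.1 ∂P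
      = ∫ q, (q.2 * inner ℝ v q.1 - inner ℝ v q.1 * inner ℝ β q.1) ∂P := by
        congr 1
        ext q
        rw [real_inner_comm β q.1]
        ring
    _ = 0 := by
        have h1 : Integrable (fun q => q.2 * inner ℝ v q.1) P :=
          hy.integrable_mul (h.memLp_inner v)
        have h2 : Integrable (fun q => inner ℝ v q.1 * inner ℝ β q.1) P :=
          (h.memLp_inner v).integrable_mul (h.memLp_inner β)
        rw [integral_sub h1 h2, hyv, h.integral_inner_mul_inner,
          sub_self]

/-- The linear functional `(a, w) ↦ a z / σ + ⟪B w, x⟫` of the normalized noise and the design. -/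
noncomputable def linearForm (β : EuclideanSpace ℝ (Fin d)) (σ : ℝ≥0)
    (B : EuclideanSpace ℝ (Fin d) →ₗ[ℝ] EuclideanSpace ℝ (Fin d))
    (q : EuclideanSpace ℝ (Fin d) × ℝ) : ℝ × EuclideanSpace ℝ (Fin d) →ₗ[ℝ] ℝ where
  toFun v := v.1 * ((q.2 - inner ℝ q.1 β) / σ) + inner ℝ (B v.2) q.1
  map_add' v w := by simp [inner_add_left]; ring
  map_smul' r v := by simp [inner_smul_left]; ring

theorem map_mul_noise (h : IsGaussianLinearModel P M β σ) (hσ : σ ≠ 0) (a : ℝ) :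
    P.map (fun q => a * ((q.2 - inner ℝ q.1 β) / σ)) = gaussianReal 0 (‖a‖₊ ^ 2) := by
  have : (fun q : EuclideanSpace ℝ (Fin d) × ℝ => a * ((q.2 - inner ℝ q.1 β) / σ)) =
      ((a / σ) * ·) ∘ fun q => q.2 - inner ℝ q.1 β := by
    ext q
    simp only [Function.comp_apply]
    ring
  rw [this, ← Measure.map_map (by fun_prop) (by fun_prop), h.law_z, gaussianReal_map_const_mul,
    mul_zero]
  congr 1
  ext
  have : (σ : ℝ) ≠ 0 := by exact_mod_cast hσ
  simp only [NNReal.coe_mul, NNReal.coe_mk, NNReal.coe_pow, coe_nnnorm, Real.norm_eq_abs, sq_abs]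
  field_simp

theorem map_inner_whitening (h : IsGaussianLinearModel P M β σ)
    {B : EuclideanSpace ℝ (Fin d) →ₗ[ℝ] EuclideanSpace ℝ (Fin d)}
    (hB : ∀ u, (multivariateGaussian 0 M).map (fun x => inner ℝ (B u) x) =
      gaussianReal 0 (‖u‖₊ ^ 2)) (u : EuclideanSpace ℝ (Fin d)) :
    P.map (fun q => inner ℝ (B u) q.1) = gaussianReal 0 (‖u‖₊ ^ 2) := by
  rw [← hB, ← h.law_x, Measure.map_map (by fun_prop) (by fun_prop)]
  rfl

theorem measurable_linearForm (β : EuclideanSpace ℝ (Fin d)) (σ : ℝ≥0)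
    (B : EuclideanSpace ℝ (Fin d) →ₗ[ℝ] EuclideanSpace ℝ (Fin d))
    (v : ℝ × EuclideanSpace ℝ (Fin d)) : Measurable fun q => linearForm β σ B q v := by
  simp only [linearForm, LinearMap.coe_mk, AddHom.coe_mk]
  fun_prop

theorem one_le_integral_linearForm_sq (h : IsGaussianLinearModel P M β σ) (hσ : σ ≠ 0)
    {B : EuclideanSpace ℝ (Fin d) →ₗ[ℝ] EuclideanSpace ℝ (Fin d)}
    (hB : ∀ u, (multivariateGaussian 0 M).map (fun x => inner ℝ (B u) x) =
      gaussianReal 0 (‖u‖₊ ^ 2)) {v : ℝ × EuclideanSpace ℝ (Fin d)} (hv : ‖v‖ = 1) :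
    1 ≤ ∫ q, linearForm β σ B q v ^ 2 ∂P := by
  have hf := h.map_mul_noise hσ v.1
  have hg := h.map_inner_whitening hB v.2
  have hfm : Measurable fun q : EuclideanSpace ℝ (Fin d) × ℝ =>
    v.1 * ((q.2 - inner ℝ q.1 β) / σ) := by fun_prop
  have hgm : Measurable fun q : EuclideanSpace ℝ (Fin d) × ℝ => inner ℝ (B v.2) q.1 := by fun_prop
  have h1 := (memLp_two_of_map_eq_gaussianReal hfm hf).integrable_sq
  have h2 := (memLp_two_of_map_eq_gaussianReal hgm hg).integrable_sq
  have h3 : Integrable (fun q : EuclideanSpace ℝ (Fin d) × ℝ =>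
      2 * v.1 / σ * ((q.2 - inner ℝ q.1 β) * inner ℝ (B v.2) q.1)) P :=
    (h.memLp_noise.integrable_mul (h.memLp_inner _)).const_mul _
  have hexp : ∀ q : EuclideanSpace ℝ (Fin d) × ℝ, linearForm β σ B q v ^ 2 =
      (v.1 * ((q.2 - inner ℝ q.1 β) / σ)) ^ 2 + inner ℝ (B v.2) q.1 ^ 2 +
        2 * v.1 / σ * ((q.2 - inner ℝ q.1 β) * inner ℝ (B v.2) q.1) := by
    intro q
    simp only [linearForm, LinearMap.coe_mk, AddHom.coe_mk]
    ring
  have h12 : Integrable (fun q : EuclideanSpace ℝ (Fin d) × ℝ =>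
    (v.1 * ((q.2 - inner ℝ q.1 β) / σ)) ^ 2 + inner ℝ (B v.2) q.1 ^ 2) P := h1.add h2
  simp only [hexp]
  rw [integral_add h12 h3, integral_add h1 h2, integral_const_mul, h.integral_noise_mul_inner,
    integral_sq_of_map_eq_gaussianReal hfm hf, integral_sq_of_map_eq_gaussianReal hgm hg]
  -- The product carries the sup norm, so one of the two components has norm exactly `1`.
  simp only [NNReal.coe_pow, coe_nnnorm, mul_zero, add_zero]
  rw [Prod.norm_def] at hv
  rcases max_choice ‖v.1‖ ‖v.2‖ with h' | h' <;> rw [h'] at hv <;> rw [hv] <;>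
    nlinarith [sq_nonneg ‖v.1‖, sq_nonneg ‖v.2‖]

theorem lintegral_exp_linearForm_sq_le (h : IsGaussianLinearModel P M β σ) (hσ : σ ≠ 0)
    {B : EuclideanSpace ℝ (Fin d) →ₗ[ℝ] EuclideanSpace ℝ (Fin d)}
    (hB : ∀ u, (multivariateGaussian 0 M).map (fun x => inner ℝ (B u) x) =
      gaussianReal 0 (‖u‖₊ ^ 2)) {v : ℝ × EuclideanSpace ℝ (Fin d)} (hv : ‖v‖ = 1) :
    ∫⁻ q, ENNReal.ofReal (Real.exp (linearForm β σ B q v ^ 2 / 16)) ∂P ≤ 2 := by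
  rw [Prod.norm_def] at hv
  have h1 : ‖v.1‖₊ ^ 2 ≤ 1 := pow_le_one₀ zero_le ((le_max_left ‖v.1‖ ‖v.2‖).trans_eq hv)
  have h2 : ‖v.2‖₊ ^ 2 ≤ 1 := pow_le_one₀ zero_le ((le_max_right ‖v.1‖ ‖v.2‖).trans_eq hv)
  exact lintegral_exp_add_sq_le (by fun_prop) (by fun_prop) h1 h2 (h.map_mul_noise hσ v.1)
    (h.map_inner_whitening hB v.2)

end IsGaussianLinearModel

/-! ### Accuracy of the least-squares value on one block. -/

theorem bddBelow_range_meanSq {n d : ℕ} (S : Fin n → EuclideanSpace ℝ (Fin d) × ℝ)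
    (G : Finset (Fin n)) : BddBelow (Set.range fun β : EuclideanSpace ℝ (Fin d) =>
      (1 / (G.card : ℝ)) * ∑ i ∈ G, ((S i).2 - inner ℝ β (S i).1) ^ 2) :=
  ⟨0, by rintro _ ⟨β, rfl⟩; positivity⟩

namespace IsGaussianLinearModel

variable {n d : ℕ} {P : Measure (EuclideanSpace ℝ (Fin d) × ℝ)} [IsProbabilityMeasure P]
  {M : Matrix (Fin d) (Fin d) ℝ} {β : EuclideanSpace ℝ (Fin d)} {σ : ℝ≥0}

theorem exists_block_event_of_pos (h : IsGaussianLinearModel P M β σ) (hσ : σ ≠ 0)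
    {G : Finset (Fin n)} (hG : G.Nonempty) :
    ∃ A : Set (Fin n → EuclideanSpace ℝ (Fin d) × ℝ), MeasurableSet A ∧
      DependsOn (fun S => S ∈ A) (G : Set (Fin n)) ∧
      (Measure.pi fun _ : Fin n => P) A ≤
        ENNReal.ofReal (3 * 201 ^ (d + 1) * Real.exp (-(G.card / 1280000))) ∧
      ∀ S, S ∉ A → 17 / 20 * (σ : ℝ) ^ 2 ≤ minMeanSq S G ∧
        minMeanSq S G ≤ 7 / 5 * (σ : ℝ) ^ 2 := by
  have hσ' : (0 : ℝ) < σ := by exact_mod_cast pos_iff_ne_zero.2 hσ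
  have hb : (0 : ℝ) < G.card := by exact_mod_cast hG.card_pos
  obtain ⟨B, hBsurj, hB⟩ := exists_whitening h.posDef
  obtain ⟨A, hAm, hAG, hPA, hA⟩ := exists_event_sum_sq_ge (P := P)
    (measurable_linearForm β σ B) (fun v hv => h.one_le_integral_linearForm_sq hσ hB hv)
    (fun v hv => h.lintegral_exp_linearForm_sq_le hσ hB hv) G
  have hlaw : P.map (fun q => (q.2 - inner ℝ q.1 β) / σ) = gaussianReal 0 1 := by
    simpa using h.map_mul_noise hσ 1
  have hzm : Measurable fun q : EuclideanSpace ℝ (Fin d) × ℝ => (q.2 - inner ℝ q.1 β) / σ := by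
    fun_prop
  let A' : Set (Fin n → EuclideanSpace ℝ (Fin d) × ℝ) :=
    {S | 7 / 5 * (G.card : ℝ) ≤ ∑ i ∈ G, (((S i).2 - inner ℝ (S i).1 β) / σ) ^ 2}
  have hPA' := measure_sum_sq_gaussian_ge_le (ι := Fin n) hzm hlaw G
  refine ⟨A ∪ A', hAm.union ?_, ?_, ?_, fun S hS => ?_⟩
  · exact measurableSet_le measurable_const (Finset.measurable_fun_sum G fun i _ =>
      (hzm.comp (measurable_pi_apply i)).pow_const 2)
  · intro S S' hSS'
    have h1 : (S ∈ A) = (S' ∈ A) := hAG hSS'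
    have h2 : ∑ i ∈ G, (((S i).2 - inner ℝ (S i).1 β) / σ) ^ 2 =
        ∑ i ∈ G, (((S' i).2 - inner ℝ (S' i).1 β) / (σ : ℝ)) ^ 2 :=
      Finset.sum_congr rfl fun i hi => by rw [hSS' i (Finset.mem_coe.2 hi)]
    simp only [Set.mem_union, h1, A', Set.mem_ofPred_eq, h2]
  · refine (measure_union_le _ _).trans ((add_le_add hPA hPA').trans ?_)
    rw [← ENNReal.ofReal_add (by positivity) (Real.exp_pos _).le]
    refine ENNReal.ofReal_le_ofReal ?_
    have hrank : Module.finrank ℝ (ℝ × EuclideanSpace ℝ (Fin d)) = d + 1 := by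
      simp [add_comm]
    rw [hrank]
    have : (1 : ℝ) ≤ 201 ^ (d + 1) := one_le_pow₀ (by norm_num)
    nlinarith [Real.exp_pos (-((G.card : ℝ) / 1280000))]
  · rw [Set.mem_union, not_or] at hS
    constructor
    · refine le_ciInf fun γ => ?_
      -- This `u` makes the residual of `γ` equal to `σ` times the form at `(1, u)`, a vector of
      -- norm at least `1` whatever `γ` is.
      obtain ⟨u, hu⟩ := hBsurj ((σ : ℝ)⁻¹ • (β - γ))
      have hkey := hA S hS.1 (1, u)
      have hnorm : 1 ≤ ‖((1 : ℝ), u)‖ := by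
        rw [Prod.norm_def]
        exact le_max_of_le_left (by simp)
      have hterm : ∀ i, (S i).2 - inner ℝ γ (S i).1 = σ * linearForm β σ B (S i) (1, u) := by
        intro i
        simp only [linearForm, LinearMap.coe_mk, AddHom.coe_mk, hu, inner_smul_left,
          inner_sub_left, real_inner_comm β (S i).1]
        simp only [RCLike.conj_to_real]
        field_simp
        ring
      simp only [hterm, mul_pow, ← Finset.mul_sum]
      rw [one_div, inv_mul_eq_div, le_div_iff₀ hb]
      have h1 : 17 / 20 * (G.card : ℝ) ≤ 17 / 20 * G.card * ‖((1 : ℝ), u)‖ ^ 2 :=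
        le_mul_of_one_le_right (by positivity) (one_le_pow₀ hnorm)
      nlinarith [sq_nonneg (σ : ℝ)]
    · refine (ciInf_le (bddBelow_range_meanSq S G) β).trans ?_
      have hlt : ∑ i ∈ G, (((S i).2 - inner ℝ (S i).1 β) / σ) ^ 2 < 7 / 5 * (G.card : ℝ) :=
        not_le.1 hS.2
      simp only [div_pow, ← Finset.sum_div, real_inner_comm β] at hlt
      rw [div_lt_iff₀ (by positivity)] at hlt
      rw [one_div, inv_mul_eq_div, div_le_iff₀ hb]
      linarith

/-- The normalization by `σ` is impossible here, but `y = ⟪x, β⟫` almost surely, so the fit is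
exact. -/
theorem exists_block_event_of_eq_zero (h : IsGaussianLinearModel P M β σ) (hσ : σ = 0)
    (G : Finset (Fin n)) :
    ∃ A : Set (Fin n → EuclideanSpace ℝ (Fin d) × ℝ), MeasurableSet A ∧
      DependsOn (fun S => S ∈ A) (G : Set (Fin n)) ∧ (Measure.pi fun _ : Fin n => P) A = 0 ∧
      ∀ S, S ∉ A → minMeanSq S G = 0 := by
  have hzm : Measurable fun q : EuclideanSpace ℝ (Fin d) × ℝ => q.2 - inner ℝ q.1 β := by
    fun_prop
  have hms : MeasurableSet {q : EuclideanSpace ℝ (Fin d) × ℝ | q.2 - inner ℝ q.1 β ≠ 0} :=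
    (hzm (measurableSet_singleton (0 : ℝ))).compl
  have hnull : P {q | q.2 - inner ℝ q.1 β ≠ 0} = 0 := by
    have hlaw := h.law_z
    rw [hσ, zero_pow two_ne_zero, gaussianReal_zero_var] at hlaw
    have h1 : (P.map fun q => q.2 - inner ℝ q.1 β) {0}ᶜ = 0 := by rw [hlaw]; simp
    rwa [Measure.map_apply hzm (measurableSet_singleton _).compl] at h1
  refine ⟨⋃ i ∈ G, {S | (S i).2 - inner ℝ (S i).1 β ≠ 0}, ?_, ?_, ?_, fun S hS => ?_⟩
  · exact G.measurableSet_biUnion fun i _ => hms.preimage (measurable_pi_apply i)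
  · intro S S' hSS'
    simp only [Set.mem_iUnion, Set.mem_ofPred_eq, exists_prop, eq_iff_iff]
    exact exists_congr fun i => and_congr_right fun hi => by rw [hSS' i (Finset.mem_coe.2 hi)]
  · refine (measure_biUnion_null_iff G.countable_toSet).2 fun i _ => ?_
    exact ((measurePreserving_eval (fun _ : Fin n => P) i).measure_preimage
      hms.nullMeasurableSet).trans hnull
  · simp only [Set.mem_iUnion, Set.mem_ofPred_eq, not_exists, not_not] at hS
    refine le_antisymm ((ciInf_le (bddBelow_range_meanSq S G) β).trans (le_of_eq ?_))
      (Real.iInf_nonneg fun γ => by positivity)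
    rw [Finset.sum_eq_zero fun i hi => ?_, mul_zero]
    rw [real_inner_comm, hS i hi, zero_pow two_ne_zero]

theorem exists_block_event (h : IsGaussianLinearModel P M β σ) {G : Finset (Fin n)}
    (hG : G.Nonempty) :
    ∃ A : Set (Fin n → EuclideanSpace ℝ (Fin d) × ℝ), MeasurableSet A ∧
      DependsOn (fun S => S ∈ A) (G : Set (Fin n)) ∧
      (Measure.pi fun _ : Fin n => P) A ≤
        ENNReal.ofReal (3 * 201 ^ (d + 1) * Real.exp (-(G.card / 1280000))) ∧
      ∀ S, S ∉ A → 17 / 20 * (σ : ℝ) ^ 2 ≤ minMeanSq S G ∧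
        minMeanSq S G ≤ 7 / 5 * (σ : ℝ) ^ 2 := by
  by_cases hσ : σ = 0
  · obtain ⟨A, hAm, hAG, hPA, hA⟩ := h.exists_block_event_of_eq_zero hσ G
    exact ⟨A, hAm, hAG, hPA.trans_le zero_le, fun S hS => by simp [hA S hS, hσ]⟩
  · exact h.exists_block_event_of_pos hσ hG

end IsGaussianLinearModel

/-! ### Choice of constants and assembly. -/

theorem card_block {n b k : ℕ} (h : k * b ≤ n) {j : ℕ} (hj : j < k) : (block n b j).card = b := by
  have hjb : (j + 1) * b ≤ n := (Nat.mul_le_mul_right b hj).trans h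
  have : (block n b j).map Fin.valEmbedding = Finset.Ico (j * b) ((j + 1) * b) := by
    ext i
    simp only [block, Finset.mem_map, Finset.mem_filter, Finset.mem_univ, true_and,
      Fin.valEmbedding_apply, Finset.mem_Ico]
    constructor
    · rintro ⟨i, hi, rfl⟩
      exact hi
    · intro hi
      exact ⟨⟨i, hi.2.trans_le hjb⟩, hi, rfl⟩
  rw [← Finset.card_map Fin.valEmbedding, this, Nat.card_Ico, add_one_mul, Nat.add_sub_cancel_left]

theorem lintegral_measure_section_le {α β : Type*} [MeasurableSpace α] [MeasurableSpace β]
    (μ : Measure α) (ν : Measure β) [SFinite ν] (s : Set (α × β)) :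
    ∫⁻ x, ν {y | (x, y) ∈ s} ∂μ ≤ (μ.prod ν) s := by
  rw [← measure_toMeasurable s, Measure.prod_apply (measurableSet_toMeasurable _ _)]
  exact lintegral_mono fun x => measure_mono fun y hy => subset_toMeasurable _ _ hy

/-- `s` need not be measurable, so only one inequality of Fubini is used; it suffices because `(1 -
ζ/2)² ≥ 1 - ζ`. -/
theorem le_measure_prod {α β : Type*} [MeasurableSpace α] [MeasurableSpace β]
    {μ : Measure α} [IsProbabilityMeasure μ] {ν : Measure β} [SFinite ν] {s : Set (α × β)}
    {bad : Set α} {ζ : ℝ} (hζ : 0 < ζ) (hζ1 : ζ < 1) (hbad : μ bad ≤ ENNReal.ofReal (ζ / 2))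
    (h : ∀ x, x ∉ bad → 1 - ENNReal.ofReal (ζ / 2) ≤ ν {y | (x, y) ∈ s}) :
    ENNReal.ofReal (1 - ζ) ≤ (μ.prod ν) s := by
  refine le_trans ?_ (lintegral_measure_section_le μ ν s)
  set D := toMeasurable μ bad
  have hD : MeasurableSet D := measurableSet_toMeasurable _ _
  have hone : 1 - ENNReal.ofReal (ζ / 2) = ENNReal.ofReal (1 - ζ / 2) := by
    rw [ENNReal.ofReal_sub 1 (by positivity), ENNReal.ofReal_one]
  have hμD : ENNReal.ofReal (1 - ζ / 2) ≤ μ Dᶜ := by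
    rw [prob_compl_eq_one_sub hD, ← hone, measure_toMeasurable]
    exact tsub_le_tsub_left hbad _
  calc ENNReal.ofReal (1 - ζ) ≤ ENNReal.ofReal (1 - ζ / 2) * ENNReal.ofReal (1 - ζ / 2) := by
        rw [← ENNReal.ofReal_mul (by linarith)]
        exact ENNReal.ofReal_le_ofReal (by nlinarith [sq_nonneg ζ])
    _ ≤ ENNReal.ofReal (1 - ζ / 2) * μ Dᶜ := by gcongr
    _ = ∫⁻ _ in Dᶜ, ENNReal.ofReal (1 - ζ / 2) ∂μ := (setLIntegral_const _ _).symm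
    _ ≤ ∫⁻ x in Dᶜ, ν {y | (x, y) ∈ s} ∂μ := by
        refine setLIntegral_mono' hD.compl fun x hx => ?_
        rw [← hone]
        exact h x fun hxb => hx (subset_toMeasurable _ _ hxb)
    _ ≤ ∫⁻ x, ν {y | (x, y) ∈ s} ∂μ := setLIntegral_le_lintegral _ _

theorem exp_neg_mul_log_inv {x : ℝ} (hx : 0 < x) (m : ℕ) :
    Real.exp (-(m * Real.log (1 / x))) = x ^ m := by
  rw [one_div, Real.log_inv, mul_neg, neg_neg, Real.exp_nat_mul, Real.exp_log hx]

/-- `38400000 = 30 * 1280000`: the exponent `30 d (1 + log (1/ε))` beats the net's `8 (d + 1)`, the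
constants, and `log (1/ε)`. -/
theorem block_failure_le {d : ℕ} (hd : 1 ≤ d) {ε b : ℝ} (hε : 0 < ε) (hε1 : ε < 1)
    (hb : 38400000 * (d * (1 + Real.log (1 / ε))) ≤ b) :
    3 * 201 ^ (d + 1) * Real.exp (-(b / 1280000)) ≤ ε / 1000 := by
  have hd' : (1 : ℝ) ≤ d := by exact_mod_cast hd
  have hl : 0 ≤ Real.log (1 / ε) := Real.log_nonneg (by rw [le_div_iff₀ hε]; linarith)
  have he2 : (2 : ℝ) ≤ Real.exp 1 := by linarith [Real.add_one_le_exp 1]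
  have h3 : (3 : ℝ) ≤ Real.exp 2 := by linarith [Real.add_one_le_exp 2]
  have h201 : (201 : ℝ) ≤ Real.exp 8 := by
    have : Real.exp 8 = Real.exp 1 ^ 8 := by rw [← Real.exp_nat_mul]; norm_num
    rw [this]
    exact le_trans (by norm_num) (pow_le_pow_left₀ zero_le_two he2 8)
  have h1000 : Real.exp (-10) ≤ 1 / 1000 := by
    have : Real.exp 10 = Real.exp 1 ^ 10 := by rw [← Real.exp_nat_mul]; norm_num
    rw [Real.exp_neg, this, ← one_div]
    exact one_div_le_one_div_of_le (by norm_num)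
      (le_trans (by norm_num) (pow_le_pow_left₀ zero_le_two he2 10))
  have hpow : (201 : ℝ) ^ (d + 1) ≤ Real.exp (8 * (d + 1)) := by
    refine (pow_le_pow_left₀ (by norm_num) h201 (d + 1)).trans (le_of_eq ?_)
    rw [← Real.exp_nat_mul]
    push_cast
    ring_nf
  calc 3 * 201 ^ (d + 1) * Real.exp (-(b / 1280000))
      ≤ Real.exp 2 * Real.exp (8 * (d + 1)) * Real.exp (-(b / 1280000)) := by gcongr
    _ = Real.exp (2 + 8 * (d + 1) + -(b / 1280000)) := by rw [Real.exp_add, Real.exp_add]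
    _ ≤ Real.exp (-10 + -(Real.log (1 / ε))) := by
        refine Real.exp_le_exp.2 ?_
        nlinarith
    _ = Real.exp (-10) * ε := by
        rw [Real.exp_add]
        have := exp_neg_mul_log_inv hε 1
        simp only [Nat.cast_one, one_mul, pow_one] at this
        rw [this]
    _ ≤ 1 / 1000 * ε := by gcongr
    _ = ε / 1000 := by ring

/-- The count is absorbed by the exponential: `4 + J ≤ 4 exp (C₁Λ/200)`, and `C₁Λ (1/80 - 1/200) ≥
4Λ`. -/
theorem card_mul_exp_neg_le {x ζ Λ C₁ J y : ℝ} (hx : 0 < x) (hxζ : x ≤ ζ) (hx2 : x ≤ 1 / 2)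
    (hΛ : Λ = Real.log (1 / x)) (hΛ0 : 0 ≤ Λ) (hC₁ : 1000 ≤ C₁) (hJ : J ≤ C₁ * Λ / 200)
    (hy : C₁ * Λ / 80 ≤ y) : (4 + J) * Real.exp (-y) ≤ ζ / 2 := by
  set u := C₁ * Λ / 200 with hu
  have hC : 1000 * Λ ≤ C₁ * Λ := by gcongr
  have hu0 : 0 ≤ u := by rw [hu]; positivity
  calc (4 + J) * Real.exp (-y) ≤ (4 * Real.exp u) * Real.exp (-y) := by
        gcongr
        linarith [Real.add_one_le_exp u]
    _ = 4 * Real.exp (u - y) := by rw [mul_assoc, ← Real.exp_add, sub_eq_add_neg]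
    _ ≤ 4 * Real.exp (-((4 : ℕ) * Λ)) := by
        gcongr
        push_cast
        linarith
    _ = 4 * x ^ 4 := by rw [hΛ, exp_neg_mul_log_inv hx]
    _ ≤ ζ / 2 := by
        have h3 : x ^ 3 ≤ (1 / 2) ^ 3 := pow_le_pow_left₀ hx.le hx2 3
        nlinarith

theorem sigmaSqEstimator_accurate {C₁ ε₀ δ₀ ζ : ℝ} (hC₁ : 1000 ≤ C₁) {n d : ℕ} (hd : 1 ≤ d)
    (hε : 0 < ε₀) (hε1 : ε₀ < 1) (hδ : 0 < δ₀) (hδ1 : δ₀ < 1) (hζ : 0 < ζ) (hζ1 : ζ < 1)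
    (hδζ : δ₀ * ζ ≤ 1 / 2)
    (hn : 38400001 * C₁ * (d * Real.log (1 / (δ₀ * ζ)) / ε₀)
      * ((1 + Real.log (1 / ε₀)) * (1 + Real.log (1 / δ₀))) ≤ n)
    {M : Matrix (Fin d) (Fin d) ℝ} {β : EuclideanSpace ℝ (Fin d)} {σ : ℝ≥0}
    {P : Measure (EuclideanSpace ℝ (Fin d) × ℝ)} [IsProbabilityMeasure P]
    (h : IsGaussianLinearModel P M β σ) :
    ENNReal.ofReal (1 - ζ) ≤
      ((Measure.pi fun _ : Fin n => P).prod (binNoise (Option ℤ)))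
        {q | ∃ l : ℝ, sigmaSqEstimator C₁ ε₀ δ₀ ζ q.1 q.2 = some l ∧
          1 / √2 * (σ : ℝ) ^ 2 ≤ l ∧ l ≤ √2 * (σ : ℝ) ^ 2} := by
  classical
  have hd' : (1 : ℝ) ≤ d := by exact_mod_cast hd
  have hx : 0 < δ₀ * ζ := mul_pos hδ hζ
  have hxζ : δ₀ * ζ ≤ ζ := mul_le_of_le_one_left hζ.le hδ1.le
  set Λ := Real.log (1 / (δ₀ * ζ)) with hΛ
  have hΛ2 : Real.log 2 ≤ Λ := Real.log_le_log two_pos (by rw [le_div_iff₀ hx]; linarith)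
  have hΛ0 : 6 / 10 ≤ Λ := by linarith [Real.log_two_gt_d9]
  have hΛδ : Real.log (1 / δ₀) ≤ Λ :=
    Real.log_le_log (by positivity)
      (one_div_le_one_div_of_le hx (mul_le_of_le_one_right hδ.le hζ1.le))
  have hlε : 0 ≤ Real.log (1 / ε₀) := Real.log_nonneg (by rw [le_div_iff₀ hε]; linarith)
  have hlδ : 0 ≤ Real.log (1 / δ₀) := Real.log_nonneg (by rw [le_div_iff₀ hδ]; linarith)
  have hCΛ : 1000 * Λ ≤ C₁ * Λ := by gcongr
  set k := numBlocks C₁ ε₀ δ₀ ζ with hkdef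
  have hk_le : (k : ℝ) ≤ C₁ * Λ / ε₀ := Nat.floor_le (by positivity)
  have hk_lt : C₁ * Λ / ε₀ < k + 1 := Nat.lt_floor_add_one _
  have hεk_le : ε₀ * k ≤ C₁ * Λ := by rwa [le_div_iff₀' hε] at hk_le
  have hεk_ge : C₁ * Λ / 2 ≤ ε₀ * k := by
    rw [div_lt_iff₀' hε] at hk_lt
    nlinarith
  have hk20 : 20 ≤ (k : ℝ) := by
    have : ε₀ * k ≤ 1 * k := by gcongr
    linarith
  have hk0 : (0 : ℝ) < k := by linarith
  have hkpos : 0 < k := by exact_mod_cast hk0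
  set b := n / k with hb
  have hkb : k * b ≤ n := Nat.mul_div_le n k
  have hb_ge : 38400000 * (d * (1 + Real.log (1 / ε₀))) ≤ (b : ℝ) := by
    have h1 : (n : ℝ) < (b + 1) * k := by
      have := Nat.lt_div_mul_add (a := n) hkpos
      have h2 : n < (b + 1) * k := by rw [add_one_mul]; exact this
      exact_mod_cast h2
    -- The extra unit in `38400001` pays for the rounding in `b = n / k`; the factor `1 + log
    -- (1/δ₀)` is at least `1` and is simply dropped.
    have h2 : 38400001 * (d * (1 + Real.log (1 / ε₀))) * k ≤ n := by
      calc 38400001 * (d * (1 + Real.log (1 / ε₀))) * k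
          ≤ 38400001 * (d * (1 + Real.log (1 / ε₀))) * (C₁ * Λ / ε₀) := by gcongr
        _ ≤ 38400001 * (d * (1 + Real.log (1 / ε₀))) * (C₁ * Λ / ε₀) *
              (1 + Real.log (1 / δ₀)) := by
            refine le_mul_of_one_le_right ?_ (by linarith)
            have : 0 ≤ C₁ * Λ := by linarith
            positivity
        _ = 38400001 * C₁ * (d * Λ / ε₀)
              * ((1 + Real.log (1 / ε₀)) * (1 + Real.log (1 / δ₀))) := by ring
        _ ≤ n := hn
    have h3 := lt_of_mul_lt_mul_right (h2.trans_lt h1) hk0.le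
    have h4 : (1 : ℝ) ≤ d * (1 + Real.log (1 / ε₀)) := by nlinarith
    linarith
  have hbpos : 0 < b := by
    have : (0 : ℝ) < b := lt_of_lt_of_le (by positivity) hb_ge
    exact_mod_cast this
  have hcard : ∀ j : Fin k, (block n b j).card = b := fun j => card_block hkb j.2
  choose E hEm hEG hPE hE using fun j : Fin k => h.exists_block_event
    (G := block n b j) (Finset.card_pos.1 (by rw [hcard]; exact hbpos))
  have hPE' : ∀ j, (Measure.pi fun _ : Fin n => P) (E j) ≤ ENNReal.ofReal (ε₀ / 1000) := by
    intro j
    refine (hPE j).trans (ENNReal.ofReal_le_ofReal ?_)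
    rw [hcard]
    exact block_failure_le hd hε hε1 hb_ge
  set m := C₁ * Λ / 200 with hm
  have hbad := measure_card_events_ge_le hEm hEG
    (fun i j hij => disjoint_block n b (Fin.val_ne_of_ne hij)) (by positivity) hPE' m
  refine le_measure_prod hζ hζ1 (hbad.trans (ENNReal.ofReal_le_ofReal ?_)) fun S hS => ?_
  -- Since `ε₀ k ≤ C₁Λ`, the exponent is at most `C₁Λ (1/500 - 1/200) ≤ -3Λ`.
  · calc Real.exp (2 * (Fintype.card (Fin k) * (ε₀ / 1000)) - m)
        ≤ Real.exp (-((2 : ℕ) * Λ)) := by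
          refine Real.exp_le_exp.2 ?_
          rw [Fintype.card_fin]
          push_cast
          linarith
      _ = (δ₀ * ζ) ^ 2 := exp_neg_mul_log_inv hx 2
      _ ≤ ζ / 2 := by nlinarith
  · simp only [Set.mem_ofPred_eq, not_le] at hS
    set J := Finset.univ.filter fun j => S ∈ E j with hJ
    obtain ⟨F, hF4, hFl, hFx⟩ := exists_finset_geomBin (sq_nonneg (σ : ℝ))
    have hF : ∀ j, j ∉ J → ∃ i ∈ F, minMeanSq S (block n b j) ∈ geomBin i := by
      intro j hj
      have hSj : S ∉ E j := by simpa [hJ] using hj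
      exact hFx _ (hE j S hSj).1 (hE j S hSj).2
    have hJk : (J.card : ℝ) ≤ k / 20 := by
      have : ε₀ * k ≤ 1 * k := by gcongr
      linarith
    have hθ : 1 / (k : ℝ) + 2 * Real.log (2 / δ₀) / (ε₀ * k) ≤ 3 / 20 := by
      have h1 : 1 / (k : ℝ) ≤ 1 / 20 := one_div_le_one_div_of_le (by norm_num) hk20
      have h2 : Real.log (2 / δ₀) = Real.log 2 + Real.log (1 / δ₀) := by
        rw [← Real.log_mul two_ne_zero (by positivity), mul_one_div]
      have h3 : 2 * Real.log (2 / δ₀) / (ε₀ * k) ≤ 1 / 10 := by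
        rw [div_le_iff₀ (by positivity), h2]
        linarith
      linarith
    refine le_trans (tsub_le_tsub_left (ENNReal.ofReal_le_ofReal ?_) _)
      ((binNoise_topBin_ge hkpos hε pairwise_disjoint_geomBin hF hF4 hJk hθ).trans
        (measure_mono ?_))
    · exact card_mul_exp_neg_le hx hxζ hδζ hΛ (by linarith) hC₁ hS.le (by linarith)
    · rintro ω ⟨i, hi, htop⟩
      refine ⟨geomBinLeft i, ?_, hFl i hi⟩
      change (topBin _).map geomBinLeft = _
      rw [htop]
      rfl

theorem mainTheorem11 :
    (∀ C₁ ε₀ δ₀ ζ : ℝ, 0 < C₁ → 0 < ε₀ → 0 < δ₀ → δ₀ < 1 → 0 < ζ → ζ < 1 →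
      ∀ n d : ℕ,
        IsDP (n := n) (binNoise (Option ℤ)) (sigmaSqEstimator (d := d) C₁ ε₀ δ₀ ζ) ε₀ δ₀) ∧
    ∃ c₁ : ℝ, 0 < c₁ ∧ ∃ p : ℕ, ∀ C₁ : ℝ, c₁ ≤ C₁ → ∃ C : ℝ, 0 < C ∧
      ∀ (n d : ℕ) (ε₀ δ₀ ζ : ℝ), 1 ≤ d → 0 < ε₀ → ε₀ < 1 → 0 < δ₀ → δ₀ < 1 → 0 < ζ → ζ < 1 →
        δ₀ * ζ ≤ 1 / 2 →
        C * (d * Real.log (1 / (δ₀ * ζ)) / ε₀)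
          * ((1 + Real.log (1 / ε₀)) * (1 + Real.log (1 / δ₀))) ^ p ≤ n →
        ∀ (M : Matrix (Fin d) (Fin d) ℝ) (β : EuclideanSpace ℝ (Fin d)) (σ : ℝ≥0)
          (P : Measure (EuclideanSpace ℝ (Fin d) × ℝ)) [IsProbabilityMeasure P],
          IsGaussianLinearModel P M β σ →
          ENNReal.ofReal (1 - ζ) ≤
            ((Measure.pi fun _ : Fin n => P).prod (binNoise (Option ℤ)))
              {q | ∃ l : ℝ, sigmaSqEstimator C₁ ε₀ δ₀ ζ q.1 q.2 = some l ∧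
                1 / √2 * (σ : ℝ) ^ 2 ≤ l ∧ l ≤ √2 * (σ : ℝ) ^ 2} := by
  refine ⟨fun C₁ ε₀ δ₀ ζ _ hε hδ hδ1 _ _ n d => sigmaSqEstimator_dp hε hδ hδ1 n d,
    1000, by norm_num, 1, fun C₁ hC₁ => ⟨38400001 * C₁, by linarith, ?_⟩⟩
  intro n d ε₀ δ₀ ζ hd hε hε1 hδ hδ1 hζ hζ1 hδζ hn M β σ P _ h
  rw [pow_one] at hn
  exact sigmaSqEstimator_accurate hC₁ hd hε hε1 hδ hδ1 hζ hζ1 hδζ hn h
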